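/- Let $k$ be a field, let $S=k[x_0,\dots,x_n]$ ($n\ge 0$) be the Cox ring of a weighted projective stack, i.e. $S$ is $\mathbb Z$-graded with $\deg x_i=d_i$, where the $d_i$ are positive integers with $d_0\le d_1\le\cdots\le d_n$, and let $B=\langle x_0,\dots,x_n\rangle$. For $0\le i\le n+1$ let $w^i=\sum_{j=n-i+1}^{n}d_j$ be the sum of the $i$ largest weights, and set $w^{-1}=-1$ and $w^{n+2}=w^{n+1}+1$. Let $S(-a)$ denote the twist with $S(-a)_e=S_{e-a}$. Let $M=\bigoplus_{e\in\mathbb Z}M_e$ be a $\mathbb Z$-graded $S$-module (not necessarily finitely generated) such that $M_e=0$ for all $e\ll 0$. Suppose that $M$ is $0$-regular, meaning that for every $0\le i\le n+1$ the local cohomology module $H^i_B M$ satisfies $(H^i_BM)_e=0$ for all $e\ge -w^{i-1}$. Then: 1. $M$ has a graded free resolution $F_0\leftarrow F_1\leftarrow\cdots\leftarrow F_{n+1}\leftarrow 0$ such that, for each $0\le i\le n+1$, $F_i$ is generated in degrees $<w^{i+1}$; that is, $F_i$ is a direct sum of modules $S(-a)$ with $a<w^{i+1}$. 2. Suppose in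 addition that $M$ is generated in degrees $\ge 0$. Then $M$ has a minimal graded free resolution (one whose differentials map $F_{i+1}$ into $BF_i$ for every $i \ge 0$), and every minimal graded free resolution $F$ of $M$ satisfies $F_i=0$ for $i>n+1$, and $i\le a<w^{i+1}$ for every summand $S(-a)$ of $F_i$, $0\le i\le n+1$. -/

import Mathlib

universe u v w

noncomputable section

namespace WeightedProj

open MvPolynomial

/-- `w^i`: the sum of the `i` largest weights, when the weights `d 0 ≤ ⋯ ≤ d n` are nondecreasing;
that is `∑_{j = n-i+1}^n d j` for `0 ≤ i ≤ n + 1`, together with the conventions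
`w^{-1} = -1` and `w^{n+2} = w^{n+1} + 1`. Only the indices `-1 ≤ i ≤ n + 2` are meaningful. -/
def topWeight {n : ℕ} (d : Fin (n + 1) → ℤ) (i : ℤ) : ℤ :=
  if i = -1 then -1
  else if i = (n : ℤ) + 2 then (∑ j, d j) + 1
  else ∑ j ∈ Finset.univ.filter (fun j : Fin (n + 1) => (n : ℤ) - i + 1 ≤ (j.val : ℤ)), d j

/-- The polynomial ring `S = k[x_0, …, x_n]`. -/
abbrev CoxRing (k : Type u) [Field k] (n : ℕ) : Type u := MvPolynomial (Fin (n + 1)) k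

/-- The `ℤ`-grading of `S` with `deg x_i = d i`. -/
abbrev coxGrading (k : Type u) [Field k] {n : ℕ} (d : Fin (n + 1) → ℤ) :
    ℤ → Submodule k (CoxRing k n) :=
  weightedHomogeneousSubmodule k d

/-- The irrelevant ideal `B = ⟨x_0, …, x_n⟩`. -/
def irrelevantIdeal (k : Type u) [Field k] (n : ℕ) : Ideal (CoxRing k n) :=
  Ideal.span (Set.range X)

section LocalCohomology

variable (k : Type u) [Field k] {n : ℕ} (M : Type v) [AddCommGroup M] [Module (CoxRing k n) M]

/-- The multiplicative set of monomials in the variables `x_i`, `i ∈ I`. -/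
def varSubmonoid (I : Finset (Fin (n + 1))) : Submonoid (CoxRing k n) :=
  Submonoid.closure (X '' (I : Set (Fin (n + 1))))

/-- The localization `M[x_i⁻¹ : i ∈ I]`. -/
abbrev CechLoc (I : Finset (Fin (n + 1))) : Type (max u v) :=
  LocalizedModule (varSubmonoid k I) M

lemma varSubmonoid_mono {I J : Finset (Fin (n + 1))} (h : I ⊆ J) :
    varSubmonoid k I ≤ varSubmonoid k J :=
  Submonoid.closure_mono (Set.image_mono (by exact_mod_cast h))

/-- For `I ⊆ J`, the canonical map `M[x_i⁻¹ : i ∈ I] → M[x_j⁻¹ : j ∈ J]`, `m / s ↦ m / s`. -/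
def cechRestrict {I J : Finset (Fin (n + 1))} (h : I ⊆ J) :
    CechLoc k M I →ₗ[CoxRing k n] CechLoc k M J :=
  LocalizedModule.lift (varSubmonoid k I) (LocalizedModule.mkLinearMap (varSubmonoid k J) M)
    fun s => IsLocalizedModule.map_units (LocalizedModule.mkLinearMap (varSubmonoid k J) M)
      ⟨s.1, varSubmonoid_mono k h s.2⟩

/-- The differential of the Čech complex `⨁_I M[x_i⁻¹ : i ∈ I]` of `M` with respect to
`x_0, …, x_n` (the summand of `I` sits in cohomological degree `|I|`): the `J`-component of `δ f`
is `∑_{j ∈ J} ± f (J \ {j})`, where the sign is `(-1)` to the number of elements of `J`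
smaller than `j`. -/
def cechDifferential :
    (∀ I : Finset (Fin (n + 1)), CechLoc k M I) →ₗ[CoxRing k n]
      (∀ I : Finset (Fin (n + 1)), CechLoc k M I) :=
  LinearMap.pi fun J => ∑ j ∈ J, ((-1 : CoxRing k n) ^ (J.filter (· < j)).card) •
    ((cechRestrict k M (J.erase_subset j)).comp (LinearMap.proj (J.erase j)))

variable (d : Fin (n + 1) → ℤ) {M} (𝓜 : ℤ → AddSubgroup M)
  [SetLike.GradedSMul (coxGrading k d) 𝓜]

/-- The elements of degree `e` in the graded module `M[x_i⁻¹ : i ∈ I]`: the fractions `m / s` with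
`s` homogeneous of some degree `a` and `m` homogeneous of degree `e + a`. -/
def cechLocDegree (I : Finset (Fin (n + 1))) (e : ℤ) : AddSubgroup (CechLoc k M I) where
  carrier := {x | ∃ (a : ℤ) (s : varSubmonoid k I) (m : M),
    (s : CoxRing k n) ∈ coxGrading k d a ∧ m ∈ 𝓜 (e + a) ∧ x = LocalizedModule.mk m s}
  zero_mem' := ⟨0, 1, 0, isWeightedHomogeneous_one k d, zero_mem _,
    (LocalizedModule.zero_mk _).symm⟩
  add_mem' := by
    rintro _ _ ⟨a, s, m, hs, hm, rfl⟩ ⟨b, t, l, ht, hl, rfl⟩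
    refine ⟨a + b, s * t, t • m + s • l, IsWeightedHomogeneous.mul hs ht, ?_,
      LocalizedModule.mk_add_mk⟩
    have h1 : (t : CoxRing k n) • m ∈ 𝓜 (b +ᵥ (e + a)) := SetLike.GradedSMul.smul_mem ht hm
    have h2 : (s : CoxRing k n) • l ∈ 𝓜 (a +ᵥ (e + b)) := SetLike.GradedSMul.smul_mem hs hl
    rw [vadd_eq_add, show b + (e + a) = e + (a + b) by ring] at h1
    rw [vadd_eq_add, show a + (e + b) = e + (a + b) by ring] at h2
    exact add_mem h1 h2
  neg_mem' := by
    rintro _ ⟨a, s, m, hs, hm, rfl⟩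
    exact ⟨a, s, -m, hs, neg_mem hm, LocalizedModule.mk_neg.symm⟩

/-- The Čech cochains of cohomological degree `p` and internal degree `e`:
`⨁_{|I| = p} M[x_i⁻¹ : i ∈ I]_e`. -/
def cechCochains (p : ℕ) (e : ℤ) : AddSubgroup (∀ I : Finset (Fin (n + 1)), CechLoc k M I) where
  carrier := {f | ∀ I, f I ∈ cechLocDegree k d 𝓜 I e ∧ (I.card ≠ p → f I = 0)}
  zero_mem' := fun _ => ⟨zero_mem _, fun _ => rfl⟩
  add_mem' := fun hf hg I => ⟨add_mem (hf I).1 (hg I).1, fun h => by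
    rw [Pi.add_apply, (hf I).2 h, (hg I).2 h, add_zero]⟩
  neg_mem' := fun hf I => ⟨neg_mem (hf I).1, fun h => by
    rw [Pi.neg_apply, (hf I).2 h, neg_zero]⟩

/-- The Čech cocycles of cohomological degree `p` and internal degree `e`. -/
def cechCocycles (p : ℕ) (e : ℤ) : AddSubgroup (∀ I : Finset (Fin (n + 1)), CechLoc k M I) :=
  cechCochains k d 𝓜 p e ⊓ (cechDifferential k M).toAddMonoidHom.ker

/-- The Čech coboundaries of cohomological degree `p` and internal degree `e`. -/
def cechCoboundaries : ℕ → ℤ → AddSubgroup (∀ I : Finset (Fin (n + 1)), CechLoc k M I)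
  | 0, _ => ⊥
  | p + 1, e => (cechCochains k d 𝓜 p e).map (cechDifferential k M).toAddMonoidHom

/-- The graded component `(H^p_B M)_e` of the `p`-th local cohomology of `M` with support in
`B = ⟨x_0, …, x_n⟩`, computed by the Čech complex of `M` on `x_0, …, x_n`. -/
abbrev LocalCohomology (p : ℕ) (e : ℤ) : Type (max u v) :=
  cechCocycles k d 𝓜 p e ⧸
    (cechCoboundaries k d 𝓜 p e).addSubgroupOf (cechCocycles k d 𝓜 p e)

/-- `M` is `0`-regular: `(H^i_B M)_e = 0` for all `e ≥ -w^{i-1}`, for `i = 0, …, n + 1`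
(`H^i_B M` vanishes for `i > n + 1`). -/
def IsZeroRegular : Prop :=
  ∀ i : ℕ, i ≤ n + 1 → ∀ e : ℤ, -topWeight d ((i : ℤ) - 1) ≤ e →
    Subsingleton (LocalCohomology k d 𝓜 i e)

end LocalCohomology

section Resolutions

variable (k : Type u) [Field k] {n : ℕ} (d : Fin (n + 1) → ℤ)

/-- The elements of degree `e` in the graded free module `⨁_b S(-a b)`, where `S(-a)_e = S_{e-a}`:
its basis element with index `b` has degree `a b`. -/
def freeDegree {ι : Type w} (a : ι → ℤ) (e : ℤ) : AddSubgroup (ι →₀ CoxRing k n) where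
  carrier := {f | ∀ b, f b ∈ coxGrading k d (e - a b)}
  zero_mem' := fun _ => zero_mem _
  add_mem' := fun hf hg b => add_mem (hf b) (hg b)
  neg_mem' := fun hf b => neg_mem (hf b)

variable {M : Type v} [AddCommGroup M] [Module (CoxRing k n) M] (𝓜 : ℤ → AddSubgroup M)

/-- A graded free resolution `⋯ → F_1 → F_0 → M → 0` of a graded `S`-module `M`, with
`F_i = ⨁_{b ∈ ι i} S(-shift i b)` and maps that are homogeneous of degree `0`. -/
structure GradedFreeResolution where
  /-- The index set of the homogeneous basis of `F_i`. -/
  ι : ℕ → Type w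
  /-- The degrees of the basis elements of `F_i`. -/
  shift : ∀ i, ι i → ℤ
  /-- The differential `F_{i+1} → F_i`. -/
  diff : ∀ i, (ι (i + 1) →₀ CoxRing k n) →ₗ[CoxRing k n] (ι i →₀ CoxRing k n)
  /-- The augmentation `F_0 → M`. -/
  aug : (ι 0 →₀ CoxRing k n) →ₗ[CoxRing k n] M
  diff_mem : ∀ i e f, f ∈ freeDegree k d (shift (i + 1)) e → diff i f ∈ freeDegree k d (shift i) e
  aug_mem : ∀ e f, f ∈ freeDegree k d (shift 0) e → aug f ∈ 𝓜 e
  aug_surjective : Function.Surjective aug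
  exact_zero : Function.Exact (diff 0) aug
  exact_succ : ∀ i, Function.Exact (diff (i + 1)) (diff i)

/-- A graded free resolution is minimal if the differential maps `F_{i+1}` into `B F_i`. -/
def GradedFreeResolution.IsMinimal {k : Type u} [Field k] {n : ℕ} {d : Fin (n + 1) → ℤ}
    {M : Type v} [AddCommGroup M] [Module (CoxRing k n) M] {𝓜 : ℤ → AddSubgroup M}
    (F : GradedFreeResolution.{u, v, w} k d 𝓜) : Prop :=
  ∀ i f b, F.diff i f b ∈ irrelevantIdeal k n

/-- `M` is generated in degree `≥ c`: it is generated as an `S`-module by its homogeneous elements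
of degree `≥ c`. -/
def GeneratedInDegreeGE (k : Type u) [Field k] (n : ℕ) {M : Type v} [AddCommGroup M]
    [Module (CoxRing k n) M] (𝓜 : ℤ → AddSubgroup M) (c : ℤ) : Prop :=
  Submodule.span (CoxRing k n) {m : M | ∃ e, c ≤ e ∧ m ∈ 𝓜 e} = ⊤

end Resolutions

end WeightedProj

end

set_option linter.unusedSectionVars false

/-! The generators of the `i`-th term of a minimal resolution sit in degrees where `Tor_i(M, k)` is
nonzero, and this Tor is the homology of the Koszul complex of `x_0, …, x_n` on `M`. The upper
bounds therefore follow once that complex is exact at place `i` in every internal degree `a ≥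
w^{i+1}` (`IsZeroRegular.koszulExact`).

For this exactness, take Koszul chains with coefficients in the Čech complex of `M`. In positive
Čech degree every summand has some `x_i` invertible, so its Koszul complex is exact. A chase through
the double complex (`koszulExact_of_resolution`) then asks only that `H^p_B M` vanish in the degrees
`a - ∑_{j ∈ J} d j` with `|J| = i + p`. Regularity gives this because `∑_{j ∈ J} d j ≤ w^{i+1} +
w^{p-1}` (`sum_le_topWeight_add`).

Tor itself is never formed. `KoszulExact.syzygy` shifts dimension along a cover with kernel in `B
F`, and `KoszulExact.shift_ne` forbids generators in degree `e` when `A_e = (B A)_e`. Iterating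
yields `GradedFreeResolution.IsMinimal.shift_ne`; it also bounds the length, since there are no
Koszul chains beyond place `n + 1`. The lower bound holds because nonzero entries of a minimal
differential have positive degree.

Existence needs no finite generation: for a module bounded below, with positive weights, graded
Nakayama shows that lifts of bases of the spaces `A_e / (B A)_e` generate, with relations in `B F`
(`exists_graded_cover`); the construction is repeated on the kernels. -/

namespace WeightedProj

/-! ### Koszul complexes and two contracting homotopies. -/

section Koszul

variable {R : Type*} [CommRing R] {σ : Type*} [LinearOrder σ]

/-- The sign `(-1)^{#{l ∈ J | l < j}}`. -/
def koszulSign (J : Finset σ) (j : σ) : ℤ := (-1) ^ (J.filter (· < j)).card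

lemma koszulSign_mul_self (J : Finset σ) (j : σ) : koszulSign J j * koszulSign J j = 1 := by
  rw [koszulSign, ← pow_add, ← two_mul, pow_mul]; simp

lemma koszulSign_insert_of_lt {J : Finset σ} {j l : σ} (hj : j ∉ J) (h : j < l) :
    koszulSign (insert j J) l = -koszulSign J l := by
  rw [koszulSign, koszulSign, Finset.filter_insert, if_pos h, Finset.card_insert_of_notMem, pow_succ]
  · ring
  · simp [hj]

lemma koszulSign_insert_of_le {J : Finset σ} {j l : σ} (h : l ≤ j) :
    koszulSign (insert j J) l = koszulSign J l := by
  rw [koszulSign, koszulSign, Finset.filter_insert, if_neg h.not_gt]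

lemma koszulSign_eq_one {J : Finset σ} {j : σ} (h : ∀ l ∈ J, j ≤ l) : koszulSign J j = 1 := by
  rw [koszulSign, Finset.filter_false_of_mem fun l hl => (h l hl).not_gt]; simp

/-- Of the two insertion orders, only the one that inserts the smaller index first makes the second
sign count it. This antisymmetry is what makes the differential square to zero. -/
lemma koszulSign_swap {J : Finset σ} {j l : σ} (hj : j ∉ J) (hl : l ∉ J) (hjl : j ≠ l) :
    koszulSign J j * koszulSign (insert j J) l = -(koszulSign J l * koszulSign (insert l J) j) := by
  rcases hjl.lt_or_gt with h | h
  · rw [koszulSign_insert_of_lt hj h, koszulSign_insert_of_le h.le]; ring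
  · rw [koszulSign_insert_of_lt hl h, koszulSign_insert_of_le h.le]; ring

variable [Fintype σ] (x : σ → R) {A : Type*} [AddCommGroup A] [Module R A]

variable (A) in
/-- The Koszul differential on `⨁_J A e_J`. -/
noncomputable def koszulDiff : (Finset σ → A) →ₗ[R] (Finset σ → A) :=
  LinearMap.pi fun J => ∑ j ∈ Jᶜ, koszulSign J j • x j • LinearMap.proj (insert j J)

lemma koszulDiff_apply (f : Finset σ → A) (J : Finset σ) :
    koszulDiff x A f J = ∑ j ∈ Jᶜ, koszulSign J j • x j • f (insert j J) := by
  simp [koszulDiff]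

lemma koszulDiff_koszulDiff (f : Finset σ → A) : koszulDiff x A (koszulDiff x A f) = 0 := by
  funext J
  simp only [koszulDiff_apply, Finset.smul_sum, Pi.zero_apply]
  rw [Finset.sum_sigma']
  refine Finset.sum_involution (fun p _ => ⟨p.2, p.1⟩) ?_ ?_ ?_ (fun _ _ => rfl)
  · rintro ⟨j, l⟩ h
    simp only [Finset.mem_sigma, Finset.mem_compl, Finset.mem_insert, not_or] at h
    simp only
    rw [Finset.insert_comm l j, smul_comm (x j), smul_comm (x l) (koszulSign (insert l J) j),
      smul_smul, smul_smul, smul_comm (x l) (x j), koszulSign_swap h.1 h.2.2 (Ne.symm h.2.1)]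
    simp only [neg_smul, mul_smul, neg_add_cancel]
  · rintro ⟨j, l⟩ h _ h'
    simp only [Finset.mem_sigma, Finset.mem_compl, Finset.mem_insert, not_or] at h
    simp only [Sigma.mk.injEq] at h'
    exact h.2.1 h'.1
  · rintro ⟨j, l⟩ h
    simp only [Finset.mem_sigma, Finset.mem_compl, Finset.mem_insert, not_or] at h ⊢
    exact ⟨h.2.2, Ne.symm h.2.1, h.1⟩

lemma koszulDiff_comp {A' : Type*} [AddCommGroup A'] [Module R A'] (φ : A →ₗ[R] A')
    (f : Finset σ → A) : koszulDiff x A' (fun J => φ (f J)) = fun J => φ (koszulDiff x A f J) := by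
  funext J
  simp [koszulDiff_apply, map_sum]

variable (d : σ → ℤ) (𝓐 : ℤ → AddSubgroup A)

/-- The elements of internal degree `a` of the `q`-th term of the Koszul complex. -/
def koszulChains (q : ℕ) (a : ℤ) : AddSubgroup (Finset σ → A) where
  carrier := {f | ∀ J, f J ∈ 𝓐 (a - ∑ j ∈ J, d j) ∧ (J.card ≠ q → f J = 0)}
  zero_mem' := fun _ => ⟨zero_mem _, fun _ => rfl⟩
  add_mem' := fun hf hg J => ⟨add_mem (hf J).1 (hg J).1, fun h => by
    rw [Pi.add_apply, (hf J).2 h, (hg J).2 h, add_zero]⟩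
  neg_mem' := fun hf J => ⟨neg_mem (hf J).1, fun h => by
    rw [Pi.neg_apply, (hf J).2 h, neg_zero]⟩

/-- Multiplication by the `x j` raises the degree by `d j`. -/
def IsGradedBy : Prop := ∀ j e m, m ∈ 𝓐 e → x j • m ∈ 𝓐 (e + d j)

/-- Exactness of the Koszul complex at the `q`-th term, in internal degree `a`. -/
def KoszulExact (q : ℕ) (a : ℤ) : Prop :=
  ∀ f ∈ koszulChains d 𝓐 q a, koszulDiff x A f = 0 →
    ∃ g ∈ koszulChains d 𝓐 (q + 1) a, koszulDiff x A g = f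

variable {x d 𝓐}

lemma koszulChains_eq_zero {q : ℕ} {a : ℤ} (hq : Fintype.card σ < q) {f : Finset σ → A}
    (hf : f ∈ koszulChains d 𝓐 q a) : f = 0 := by
  funext J
  exact (hf J).2 ((Finset.card_le_univ J).trans_lt hq).ne

lemma koszulDiff_mem (hx : IsGradedBy x d 𝓐) {q : ℕ} {a : ℤ} {f : Finset σ → A}
    (hf : f ∈ koszulChains d 𝓐 (q + 1) a) : koszulDiff x A f ∈ koszulChains d 𝓐 q a := by
  intro J
  rw [koszulDiff_apply]
  constructor
  · refine sum_mem fun j hj => zsmul_mem ?_ _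
    have h := hx j _ _ (hf (insert j J)).1
    rw [Finset.sum_insert (by simpa using hj)] at h
    convert h using 2
    ring
  · intro h
    refine Finset.sum_eq_zero fun j hj => ?_
    rw [(hf (insert j J)).2, smul_zero, smul_zero]
    rw [Finset.card_insert_of_notMem (by simpa using hj)]
    omega

lemma koszulChains_map {A' : Type*} [AddCommGroup A'] {𝓐' : ℤ → AddSubgroup A'} (φ : A → A')
    (h0 : φ 0 = 0) (hφ : ∀ e, ∀ m ∈ 𝓐 e, φ m ∈ 𝓐' e) {q : ℕ} {a : ℤ} {f : Finset σ → A}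
    (hf : f ∈ koszulChains d 𝓐 q a) : (fun J => φ (f J)) ∈ koszulChains d 𝓐' q a :=
  fun J => ⟨hφ _ _ (hf J).1, fun h => by simp only [(hf J).2 h, h0]⟩

/-- The Koszul complex is exact when one of the `x i` is invertible on the module. -/
lemma koszulExact_of_invertible {i : σ} (u : A →ₗ[R] A) (hu : ∀ m, x i • u m = m)
    (hdeg : ∀ e, ∀ m ∈ 𝓐 e, u m ∈ 𝓐 (e - d i)) (q : ℕ) (a : ℤ) : KoszulExact x d 𝓐 q a := by
  intro f hf hf0
  -- The homotopy is exterior multiplication by `e_i` followed by division by `x i`.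
  refine ⟨fun J => if i ∈ J then koszulSign (J.erase i) i • u (f (J.erase i)) else 0, ?_, ?_⟩
  · intro J
    by_cases hi : i ∈ J
    · simp only [if_pos hi]
      refine ⟨zsmul_mem ?_ _, fun h => ?_⟩
      · have := hdeg _ _ (hf (J.erase i)).1
        rwa [sub_sub, Finset.sum_erase_add J d hi] at this
      · rw [(hf (J.erase i)).2, map_zero, smul_zero]
        rw [Finset.card_erase_of_mem hi]
        have := Finset.card_pos.2 ⟨i, hi⟩
        omega
    · simp only [if_neg hi]
      exact ⟨zero_mem _, fun _ => trivial⟩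
  · funext J
    rw [koszulDiff_apply]
    by_cases hi : i ∈ J
    · obtain ⟨J', hJ', rfl⟩ : ∃ J', i ∉ J' ∧ insert i J' = J :=
        ⟨J.erase i, by simp, Finset.insert_erase hi⟩
      have h0 := congrFun hf0 J'
      rw [koszulDiff_apply, ← Finset.add_sum_erase _ _ (Finset.mem_compl.2 hJ'), Pi.zero_apply,
        ← Finset.compl_insert] at h0
      -- Dividing the cycle relation at `J'` by `x i` solves it for the coefficient of `f` at
      -- `insert i J'`.
      have h1 := congrArg (fun m => koszulSign J' i • u m) h0
      simp only [map_add, map_zsmul, map_smul, hu, smul_add, smul_smul, koszulSign_mul_self,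
        one_smul, map_zero, smul_zero, map_sum, Finset.smul_sum] at h1
      rw [eq_comm, ← sub_eq_zero, sub_eq_add_neg, ← h1, ← Finset.sum_neg_distrib]
      congr 1
      refine Finset.sum_congr rfl fun j hj => ?_
      simp only [Finset.mem_compl, Finset.mem_insert, not_or] at hj
      rw [if_pos (by simp), Finset.insert_comm j i, Finset.erase_insert (by simp [hJ', Ne.symm hj.1]),
        smul_comm (x j) (koszulSign _ _), smul_smul, ← neg_smul]
      congr 1
      have h2 := koszulSign_swap hJ' hj.2 (Ne.symm hj.1)
      have h3 := koszulSign_mul_self J' i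
      have h4 := koszulSign_mul_self (insert j J') i
      linear_combination -(koszulSign J' i * koszulSign (insert j J') i) * h2 +
        koszulSign (insert i J') j * koszulSign (insert j J') i * h3 +
        koszulSign J' i * koszulSign J' j * h4
    · rw [Finset.sum_eq_single i]
      · rw [if_pos (by simp), Finset.erase_insert hi, smul_comm (x i) (koszulSign _ _), hu, smul_smul,
          koszulSign_mul_self, one_smul]
      · intro j _ hji
        rw [if_neg (by simp [hi, Ne.symm hji]), smul_zero, smul_zero]
      · intro h
        simp [hi] at h

/-- A contracting homotopy of the Koszul complex from operators `T m` of "division by `x m` of the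
terms whose smallest variable is `x m`". -/
lemma koszulExact_of_division (T : σ → A →+ A)
    (hdeg : ∀ m e, ∀ y ∈ 𝓐 e, T m y ∈ 𝓐 (e - d m))
    (hgt : ∀ m j y, m < j → T m (x j • y) = x j • T m y)
    (hlt : ∀ m j y, j < m → T m (x j • y) = 0)
    (heq : ∀ m y, T m (x m • y) + ∑ j ∈ Finset.univ.filter (· < m), x j • T j y = y)
    {q : ℕ} {a : ℤ} {f : Finset σ → A} (hf : f ∈ koszulChains d 𝓐 q a) (hf0 : koszulDiff x A f = 0)
    (hempty : ∑ j, x j • T j (f ∅) = f ∅) :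
    ∃ g ∈ koszulChains d 𝓐 (q + 1) a, koszulDiff x A g = f := by
  -- The homotopy moves a variable from the coefficient into the index set, provided that it becomes
  -- the smallest index there.
  let g : Finset σ → A := fun J => if h : J.Nonempty then T (J.min' h) (f (J.erase (J.min' h))) else 0
  have hg : ∀ J m, m ∉ J → (∀ l ∈ J, m ≤ l) → g (insert m J) = T m (f J) := by
    intro J m hm hl
    have hne : (insert m J).Nonempty := Finset.insert_nonempty m J
    have hmin : (insert m J).min' hne = m := by
      refine le_antisymm (Finset.min'_le _ _ (by simp)) (Finset.le_min' _ _ _ fun l h => ?_)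
      rcases Finset.mem_insert.1 h with rfl | h
      exacts [le_rfl, hl l h]
    simp only [g, dif_pos hne, hmin, Finset.erase_insert hm]
  have hcases : ∀ J : Finset σ, J = ∅ ∨ ∃ m J', m ∉ J' ∧ (∀ l ∈ J', m < l) ∧ insert m J' = J := by
    intro J
    rcases J.eq_empty_or_nonempty with h | h
    · exact Or.inl h
    · refine Or.inr ⟨J.min' h, J.erase (J.min' h), by simp, fun l hl => ?_,
        Finset.insert_erase (J.min'_mem h)⟩
      exact Finset.min'_lt_of_mem_erase_min' J h hl
  refine ⟨g, fun J => ?_, ?_⟩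
  · rcases hcases J with rfl | ⟨m, J', hm, hl, rfl⟩
    · simp [g]
    · rw [hg J' m hm fun l h => (hl l h).le, Finset.sum_insert hm, Finset.card_insert_of_notMem hm]
      refine ⟨?_, fun h => ?_⟩
      · have := hdeg m _ _ (hf J').1
        convert this using 2
        ring
      · rw [(hf J').2 (by omega), map_zero]
  · funext J
    rw [koszulDiff_apply]
    rcases hcases J with rfl | ⟨m, J', hm, hl, rfl⟩
    · rw [Finset.compl_empty]
      refine Eq.trans ?_ hempty
      refine Finset.sum_congr rfl fun j _ => ?_
      rw [hg ∅ j (by simp) (by simp), koszulSign_eq_one (by simp), one_smul]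
    -- Here `m` is the smallest index of `J`. Applying `T m` to the cycle relation at `J'` kills the
    -- terms `j < m` and matches the terms `j > m`, up to sign, with those of the differential of
    -- `g`; what remains is `heq`.
    · have h0 := congrArg (T m) (congrFun hf0 J')
      rw [koszulDiff_apply, ← Finset.add_sum_erase _ _ (Finset.mem_compl.2 hm), Pi.zero_apply,
        ← Finset.compl_insert, koszulSign_eq_one fun l h => (hl l h).le, one_smul, map_add,
        map_zero, map_sum, ← Finset.sum_filter_add_sum_filter_not _ (· < m)] at h0
      rw [← Finset.sum_filter_add_sum_filter_not _ (· < m)]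
      have h1 : ∑ j ∈ (insert m J')ᶜ.filter (· < m), T m (koszulSign J' j • x j • f (insert j J'))
          = 0 := by
        refine Finset.sum_eq_zero fun j hj => ?_
        rw [map_zsmul, hlt _ _ _ (Finset.mem_filter.1 hj).2, smul_zero]
      have h2 : ∑ j ∈ (insert m J')ᶜ.filter (¬ · < m),
          koszulSign (insert m J') j • x j • g (insert j (insert m J')) =
          -∑ j ∈ (insert m J')ᶜ.filter (¬ · < m),
            T m (koszulSign J' j • x j • f (insert j J')) := by
        rw [← Finset.sum_neg_distrib]
        refine Finset.sum_congr rfl fun j hj => ?_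
        simp only [Finset.mem_filter, Finset.mem_compl, Finset.mem_insert, not_or, not_lt] at hj
        have hmj : m < j := lt_of_le_of_ne hj.2 (Ne.symm hj.1.1)
        rw [Finset.insert_comm, hg, map_zsmul, hgt _ _ _ hmj, koszulSign_insert_of_lt hm hmj, neg_smul]
        · simp [hm, Ne.symm hj.1.1]
        · intro l h
          rcases Finset.mem_insert.1 h with rfl | h
          exacts [hj.2, (hl l h).le]
      have h3 : ∑ j ∈ (insert m J')ᶜ.filter (· < m),
          koszulSign (insert m J') j • x j • g (insert j (insert m J')) =
          ∑ j ∈ Finset.univ.filter (· < m), x j • T j (f (insert m J')) := by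
        have hlt' : ∀ j < m, ∀ l ∈ insert m J', j < l := by
          intro j hj l h
          rcases Finset.mem_insert.1 h with rfl | h
          exacts [hj, hj.trans (hl l h)]
        refine Finset.sum_congr ?_ fun j hj => ?_
        · ext j
          simp only [Finset.mem_filter, Finset.mem_compl, Finset.mem_univ, true_and,
            and_iff_right_iff_imp]
          exact fun h h' => (hlt' j h j h').false
        · have hjm := (Finset.mem_filter.1 hj).2
          rw [koszulSign_eq_one fun l h => (hlt' j hjm l h).le, one_smul,
            hg _ _ (fun h => (hlt' j hjm j h).false) fun l h => (hlt' j hjm l h).le]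
      have h4 := heq m (f (insert m J'))
      rw [h1, zero_add] at h0
      rw [h2, h3, ← eq_neg_of_add_eq_zero_left h0, add_comm]
      exact h4

end Koszul

open MvPolynomial

/-! ### Splitting a polynomial by the smallest variable of each term. -/

section Division

variable {k : Type*} [Field k] {σ : Type*} [LinearOrder σ]

open Classical in
/-- Division by `X m` of the terms of a polynomial whose smallest variable is `X m`. -/
noncomputable def divMin (m : σ) : MvPolynomial σ k →+ MvPolynomial σ k :=
  AddMonoidHom.mk' (fun p => AddMonoidAlgebra.ofCoeff
    ((AddMonoidAlgebra.coeff (divMonomial p (Finsupp.single m 1))).filter fun γ => ∀ l < m, γ l = 0))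
    fun p q => by simp [add_divMonomial, Finsupp.filter_add]

open Classical in
lemma coeff_divMin (m : σ) (p : MvPolynomial σ k) (γ : σ →₀ ℕ) :
    (divMin m p).coeff γ =
      if ∀ l < m, γ l = 0 then p.coeff (γ + Finsupp.single m 1) else 0 := by
  refine (Finsupp.filter_apply _ _ _).trans ?_
  rw [add_comm γ, ← coeff_divMonomial]
  rfl

lemma divMin_X_mul_of_lt {m j : σ} (h : m < j) (p : MvPolynomial σ k) :
    divMin m (X j * p) = X j * divMin m p := by
  classical
  ext γ
  rw [coeff_divMin, coeff_X_mul', coeff_X_mul', coeff_divMin]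
  have h1 : (∀ l < m, (γ - Finsupp.single j 1 : σ →₀ ℕ) l = 0) ↔ ∀ l < m, γ l = 0 := by
    refine forall₂_congr fun l hl => ?_
    simp [(hl.trans h).ne]
  have h2 : j ∈ (γ + Finsupp.single m 1).support ↔ j ∈ γ.support := by
    simp [h.ne]
  simp only [h1, h2]
  split_ifs with h3 h4 <;> try rfl
  congr 1
  ext l
  by_cases hl : l = j
  · subst hl; simp [h.ne]
  · simp [Finsupp.single_apply, Ne.symm hl]

lemma divMin_X_mul_of_gt {m j : σ} (h : j < m) (p : MvPolynomial σ k) :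
    divMin m (X j * p) = 0 := by
  classical
  ext γ
  rw [coeff_divMin, coeff_X_mul']
  split_ifs with h1 h2
  · simp [h1 j h, h.ne'] at h2
  · simp
  · simp

open Classical in
-- Multiplying back by `X j` recovers exactly the terms of `p` whose smallest variable is `X j`, so
-- for varying `j` these products are disjoint pieces of `p`.
lemma coeff_X_mul_divMin (j : σ) (p : MvPolynomial σ k) (γ : σ →₀ ℕ) :
    (X j * divMin j p).coeff γ = if γ j ≠ 0 ∧ ∀ l < j, γ l = 0 then p.coeff γ else 0 := by
  rw [coeff_X_mul', coeff_divMin]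
  by_cases h : γ j = 0
  · simp [h]
  · have h1 : (∀ l < j, (γ - Finsupp.single j 1 : σ →₀ ℕ) l = 0) ↔ ∀ l < j, γ l = 0 := by
      refine forall₂_congr fun l hl => ?_
      simp [hl.ne]
    have h2 : γ - Finsupp.single j 1 + Finsupp.single j 1 = γ :=
      tsub_add_cancel_of_le (by simpa [Finsupp.single_le_iff] using Nat.one_le_iff_ne_zero.2 h)
    rw [if_pos (by simpa using h), h2, h1]
    simp [h]

/-- As `s` is an initial segment, a monomial involving a variable of `s` has its smallest variable
in `s`, and exactly one summand sees it. -/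
lemma sum_coeff_X_mul_divMin {s : Finset σ} (hs : ∀ i ∈ s, ∀ j < i, j ∈ s) (p : MvPolynomial σ k)
    {γ : σ →₀ ℕ} (hγ : ∃ i ∈ s, γ i ≠ 0) : ∑ j ∈ s, (X j * divMin j p).coeff γ = p.coeff γ := by
  classical
  obtain ⟨i, his, hi⟩ := hγ
  have hne : γ.support.Nonempty := ⟨i, by simpa using hi⟩
  have hm := γ.support.min'_mem hne
  have hle : ∀ l, γ l ≠ 0 → γ.support.min' hne ≤ l := fun l hl =>
    Finset.min'_le _ _ (by simpa using hl)
  rw [Finset.sum_eq_single (γ.support.min' hne), coeff_X_mul_divMin, if_pos]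
  · refine ⟨by simpa using hm, fun l hl => ?_⟩
    by_contra h
    exact (hle l h).not_gt hl
  · intro j _ hj
    rw [coeff_X_mul_divMin, if_neg]
    rintro ⟨h1, h2⟩
    exact (by simpa using hm : γ (γ.support.min' hne) ≠ 0)
      (h2 _ (lt_of_le_of_ne (hle j h1) (Ne.symm hj)))
  · intro h
    rcases (hle i hi).eq_or_lt with h' | h'
    · exact absurd (h' ▸ his) h
    · exact absurd (hs i his _ h') h

/-- A monomial free of variables below `X m` survives multiplication and division by `X m`; any
other monomial is caught by the sum. -/
lemma divMin_X_mul_add_sum [Fintype σ] (m : σ) (p : MvPolynomial σ k) :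
    divMin m (X m * p) + ∑ j ∈ Finset.univ.filter (· < m), X j * divMin j p = p := by
  classical
  ext γ
  rw [coeff_add, coeff_divMin, coeff_sum, add_comm γ, coeff_X_mul]
  split_ifs with h
  · rw [Finset.sum_eq_zero, add_zero]
    intro j hj
    rw [coeff_X_mul_divMin, if_neg]
    simp [h j (by simpa using hj)]
  · push Not at h
    rw [zero_add, sum_coeff_X_mul_divMin]
    · intro i hi j hj
      simp only [Finset.mem_filter, Finset.mem_univ, true_and] at hi ⊢
      exact hj.trans hi
    · simpa using h

lemma sum_X_mul_divMin [Fintype σ] {p : MvPolynomial σ k} (hp : p.coeff 0 = 0) :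
    ∑ j, X j * divMin j p = p := by
  classical
  ext γ
  rw [coeff_sum]
  by_cases hγ : γ = 0
  · rw [hγ, hp]
    exact Finset.sum_eq_zero fun j _ => by rw [coeff_X_mul_divMin]; simp
  · rw [sum_coeff_X_mul_divMin (by simp)]
    obtain ⟨i, hi⟩ := Finsupp.ne_iff.1 hγ
    exact ⟨i, by simp, hi⟩

lemma divMin_mem {d : σ → ℤ} {m : σ} {e : ℤ} {p : MvPolynomial σ k}
    (hp : p ∈ weightedHomogeneousSubmodule k d e) :
    divMin m p ∈ weightedHomogeneousSubmodule k d (e - d m) := by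
  classical
  intro γ hγ
  rw [coeff_divMin] at hγ
  split_ifs at hγ with h
  · have := hp hγ
    rw [map_add, Finsupp.weight_single, one_smul] at this
    omega
  · simp at hγ

end Division

/-! ### Graded free modules: Koszul acyclicity and decomposition. -/

section Free

variable {k : Type u} [Field k] {n : ℕ} {d : Fin (n + 1) → ℤ} {ι : Type w} {a : ι → ℤ}

lemma mem_irrelevantIdeal {p : CoxRing k n} : p ∈ irrelevantIdeal k n ↔ p.coeff 0 = 0 := by
  have := mem_pow_idealOfVars_iff' (σ := Fin (n + 1)) (R := k) 1 p
  rw [pow_one] at this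
  refine this.trans ⟨fun h => h 0 (by simp), fun h γ hγ => ?_⟩
  rw [Nat.lt_one_iff, Finsupp.degree_eq_zero_iff] at hγ
  rw [hγ, h]

lemma isGradedBy_of_gradedSMul {M : Type v} [AddCommGroup M] [Module (CoxRing k n) M]
    (𝓜 : ℤ → AddSubgroup M) [SetLike.GradedSMul (coxGrading k d) 𝓜] :
    IsGradedBy (X : _ → CoxRing k n) d 𝓜 := by
  intro j e m hm
  have : (X j : CoxRing k n) • m ∈ 𝓜 (d j +ᵥ e) :=
    SetLike.GradedSMul.smul_mem (A := coxGrading k d) (isWeightedHomogeneous_X k d j) hm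
  rwa [vadd_eq_add, add_comm] at this

variable (k d a) in
/-- The family of additive subgroups `freeDegree` is stable under the action of `S`. -/
instance freeDegree_gradedSMul : SetLike.GradedSMul (coxGrading k d) (freeDegree k d a) where
  smul_mem {i j p f} hp hf b := by
    have : p * f b ∈ coxGrading k d (i + (j - a b)) := IsWeightedHomogeneous.mul hp (hf b)
    rw [Finsupp.smul_apply, smul_eq_mul, vadd_eq_add]
    convert this using 2
    ring

/-- This is the vanishing of `Tor_q(F, k)` for `q > 0` together with `Tor_0(F, k) = F / B F`. The
hypothesis `hB` has content only for `q = 0`, since otherwise `f ∅ = 0`. -/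
lemma exists_koszulDiff_eq_of_free {q : ℕ} {e : ℤ} {f : Finset (Fin (n + 1)) → (ι →₀ CoxRing k n)}
    (hf : f ∈ koszulChains d (freeDegree k d a) q e) (hf0 : koszulDiff (X : _ → CoxRing k n) _ f = 0)
    (hB : ∀ b, f ∅ b ∈ irrelevantIdeal k n) :
    ∃ g ∈ koszulChains d (freeDegree k d a) (q + 1) e,
      koszulDiff (X : _ → CoxRing k n) _ g = f := by
  refine koszulExact_of_division
    (T := fun m => Finsupp.mapRange.addMonoidHom (divMin m)) ?_ ?_ ?_ ?_ hf hf0 ?_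
  · intro m e y hy b
    have := divMin_mem (m := m) (hy b)
    simp only [Finsupp.mapRange.addMonoidHom_apply, Finsupp.mapRange_apply]
    rwa [show e - d m - a b = e - a b - d m by ring]
  · intro m j y h
    ext b : 1
    simp [divMin_X_mul_of_lt h]
  · intro m j y h
    ext b : 1
    simp [divMin_X_mul_of_gt h]
  · intro m y
    ext b : 1
    simpa [Finsupp.finsetSum_apply] using divMin_X_mul_add_sum m (y b)
  · ext b : 1
    simpa [Finsupp.finsetSum_apply] using sum_X_mul_divMin (mem_irrelevantIdeal.1 (hB b))

/-- The component of degree `e` of an element of a graded free module. -/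
noncomputable def freeComponent (d : Fin (n + 1) → ℤ) (a : ι → ℤ) (e : ℤ) :
    (ι →₀ CoxRing k n) →+ (ι →₀ CoxRing k n) where
  toFun f := Finsupp.onFinset f.support (fun b => weightedHomogeneousComponent d (e - a b) (f b))
    fun b h => by
      rw [Finsupp.mem_support_iff]
      rintro h'
      simp [h'] at h
  map_zero' := by ext; simp
  map_add' f g := by ext; simp

lemma freeComponent_apply (e : ℤ) (f : ι →₀ CoxRing k n) (b : ι) :
    freeComponent d a e f b = weightedHomogeneousComponent d (e - a b) (f b) := rfl

lemma freeComponent_same {e : ℤ} {f : ι →₀ CoxRing k n} (hf : f ∈ freeDegree k d a e) :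
    freeComponent d a e f = f := by
  ext b : 1
  rw [freeComponent_apply, (hf b).weightedHomogeneousComponent_same]

lemma freeComponent_ne {e e' : ℤ} (h : e ≠ e') {f : ι →₀ CoxRing k n}
    (hf : f ∈ freeDegree k d a e) : freeComponent d a e' f = 0 := by
  ext b : 1
  rw [freeComponent_apply, (hf b).weightedHomogeneousComponent_ne _ (by omega), Finsupp.zero_apply]

lemma single_mem_freeDegree {b : ι} {e : ℤ} {p : CoxRing k n} (hp : p ∈ coxGrading k d (e - a b)) :
    Finsupp.single b p ∈ freeDegree k d a e := by
  classical
  intro b'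
  rw [Finsupp.single_apply]
  split_ifs with h
  · exact h ▸ hp
  · exact zero_mem _

variable (k d a) in
lemma freeDegree_isInternal : DirectSum.IsInternal (freeDegree k d a) := by
  classical
  have key : ∀ (y : DirectSum ℤ fun e => freeDegree k d a e) (e : ℤ),
      freeComponent d a e (DirectSum.coeAddMonoidHom _ y) = y e := by
    intro y e
    induction y using DirectSum.induction_on with
    | zero => simp
    | of e' x =>
      rw [DirectSum.coeAddMonoidHom_of]
      by_cases h : e' = e
      · subst h
        rw [freeComponent_same x.2, DirectSum.of_eq_same]
      · rw [freeComponent_ne h x.2, DirectSum.of_eq_of_ne _ _ _ (Ne.symm h)]; rfl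
    | add x y hx hy => rw [map_add, map_add, hx, hy]; rfl
  constructor
  · intro y z h
    ext e : 2
    rw [← key, ← key, h]
  · intro f
    change f ∈ AddMonoidHom.mrange (DirectSum.coeAddMonoidHom (freeDegree k d a))
    induction f using Finsupp.induction_linear with
    | zero => exact zero_mem _
    | add f g hf hg => exact add_mem hf hg
    | single b p =>
      rw [← sum_weightedHomogeneousComponent d p, finsum_eq_sum _
        (weightedHomogeneousComponent_finsupp p), Finsupp.single_finsetSum]
      refine sum_mem fun e _ => ⟨DirectSum.of _ (e + a b) ⟨Finsupp.single b
        (weightedHomogeneousComponent d e p), single_mem_freeDegree ?_⟩, ?_⟩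
      · rw [add_sub_cancel_right]
        exact weightedHomogeneousComponent_mem _ _ _
      · rw [DirectSum.coeAddMonoidHom_of]

variable (k d a) in
noncomputable instance freeDegree_decomposition : DirectSum.Decomposition (freeDegree k d a) :=
  (freeDegree_isInternal k d a).chooseDecomposition

end Free

lemma decompose_map {A B : Type*} [AddCommGroup A] [AddCommGroup B] (𝓐 : ℤ → AddSubgroup A)
    (𝓑 : ℤ → AddSubgroup B) [DirectSum.Decomposition 𝓐] [DirectSum.Decomposition 𝓑] (φ : A →+ B)
    (hφ : ∀ e, ∀ f ∈ 𝓐 e, φ f ∈ 𝓑 e) (f : A) (e : ℤ) :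
    (DirectSum.decompose 𝓑 (φ f) e : B) = φ (DirectSum.decompose 𝓐 f e) := by
  induction f using DirectSum.Decomposition.inductionOn 𝓐 with
  | zero => simp
  | @homogeneous i m =>
    by_cases h : i = e
    · subst h
      rw [DirectSum.decompose_of_mem_same _ (hφ _ _ m.2), DirectSum.decompose_of_mem_same _ m.2]
    · rw [DirectSum.decompose_of_mem_ne _ (hφ _ _ m.2) h, DirectSum.decompose_of_mem_ne _ m.2 h,
        map_zero]
  | add m m' h h' => simp [map_add, DirectSum.decompose_add, h, h']

/-! ### The chase in the Koszul–Čech double complex. -/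

section Zigzag

variable {R : Type*} [CommRing R] {σ : Type*} [LinearOrder σ] [Fintype σ] {x : σ → R}
  {A : Type*} [AddCommGroup A] [Module R A] {d : σ → ℤ}

/-- The terms of a graded complex, moved by one step. -/
def shiftedTerm (𝓒 : ℕ → ℤ → AddSubgroup A) : ℕ → ℤ → AddSubgroup A
  | 0, _ => ⊥
  | p + 1, e => 𝓒 p e

/-- Write `∂` for the Koszul differential. Since `δ y` is a `∂`-cycle, it equals `∂ y'` one step
further along the diagonal; by induction `y' = δ u' + ∂ v'`. Then `y - ∂ u'` is `δ`-closed, hence in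
the image of `δ` by `hH`. The induction starts beyond the last Koszul term, where all chains are
zero. -/
lemma exists_add_koszulDiff_eq (δ : A →ₗ[R] A) (𝓒 : ℕ → ℤ → AddSubgroup A)
    (hδ : ∀ p e, ∀ c ∈ 𝓒 p e, δ c ∈ 𝓒 (p + 1) e) (hδδ : ∀ c, δ (δ c) = 0)
    (hx : ∀ p, IsGradedBy x d (𝓒 p)) (hK : ∀ p q a, KoszulExact x d (𝓒 (p + 1)) q a) {i : ℕ} {a : ℤ}
    (hH : ∀ p (J : Finset σ), J.card = i + p → ∀ c ∈ 𝓒 p (a - ∑ j ∈ J, d j), δ c = 0 →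
      ∃ b ∈ shiftedTerm 𝓒 p (a - ∑ j ∈ J, d j), δ b = c)
    (m : ℕ) : ∀ p, Fintype.card σ < i + p + m → ∀ y ∈ koszulChains d (𝓒 p) (i + p) a,
      (∀ J, δ (koszulDiff x A y J) = 0) →
      ∃ u ∈ koszulChains d (shiftedTerm 𝓒 p) (i + p) a, ∃ v ∈ koszulChains d (𝓒 p) (i + p + 1) a,
        y = (fun J => δ (u J)) + koszulDiff x A v := by
  induction m with
  | zero =>
    intro p hp y hy _
    exact ⟨0, zero_mem _, 0, zero_mem _, by
      rw [koszulChains_eq_zero hp hy]; funext J; simp⟩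
  | succ m ih =>
    intro p hp y hy hy0
    obtain ⟨y', hy', hyy'⟩ := hK p (i + p) a (fun J => δ (y J))
      (koszulChains_map δ (map_zero δ) (fun e c => hδ p e c) hy)
      (by rw [koszulDiff_comp]; exact funext hy0)
    obtain ⟨u', hu', v', hv', rfl⟩ := ih (p + 1) (by omega) y' hy' fun J => by
      rw [hyy', hδδ]
    rw [map_add, koszulDiff_koszulDiff, add_zero, koszulDiff_comp] at hyy'
    have hu'' : u' ∈ koszulChains d (𝓒 p) (i + p + 1) a := hu'
    have hw : y - koszulDiff x A u' ∈ koszulChains d (𝓒 p) (i + p) a :=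
      sub_mem hy (koszulDiff_mem (hx p) hu'')
    have hex : ∀ J : Finset σ, ∃ b ∈ shiftedTerm 𝓒 p (a - ∑ j ∈ J, d j),
        (J.card ≠ i + p → b = 0) ∧ δ b = (y - koszulDiff x A u') J := by
      intro J
      by_cases hJ : J.card = i + p
      · obtain ⟨b, hb, hbc⟩ := hH p J hJ _ (hw J).1 (by
          rw [Pi.sub_apply, map_sub, ← congrFun hyy' J, sub_self])
        exact ⟨b, hb, fun h => absurd hJ h, hbc⟩
      · exact ⟨0, zero_mem _, fun _ => rfl, by rw [map_zero, (hw J).2 hJ]⟩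
    choose u hu1 hu2 hu3 using hex
    refine ⟨u, fun J => ⟨hu1 J, hu2 J⟩, u', hu'', ?_⟩
    funext J
    rw [Pi.add_apply, hu3, Pi.sub_apply, sub_add_cancel]

lemma koszulExact_of_resolution (δ : A →ₗ[R] A) (𝓒 : ℕ → ℤ → AddSubgroup A)
    (hδ : ∀ p e, ∀ c ∈ 𝓒 p e, δ c ∈ 𝓒 (p + 1) e) (hδδ : ∀ c, δ (δ c) = 0)
    (hx : ∀ p, IsGradedBy x d (𝓒 p)) (hK : ∀ p q a, KoszulExact x d (𝓒 (p + 1)) q a) {i : ℕ} {a : ℤ}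
    (hH : ∀ p (J : Finset σ), J.card = i + p → ∀ c ∈ 𝓒 p (a - ∑ j ∈ J, d j), δ c = 0 →
      ∃ b ∈ shiftedTerm 𝓒 p (a - ∑ j ∈ J, d j), δ b = c) :
    KoszulExact x d (𝓒 0) i a := by
  intro z hz hz0
  obtain ⟨u, hu, v, hv, h⟩ := exists_add_koszulDiff_eq δ 𝓒 hδ hδδ hx hK hH (Fintype.card σ + 1) 0
    (by omega) z hz (by simp [hz0])
  refine ⟨v, hv, ?_⟩
  rw [h]
  funext J
  -- Nothing precedes the zeroth term: `shiftedTerm` is `⊥` there, so only the Koszul boundary is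
  -- left.
  have : u J = 0 := (hu J).1
  simp [this]

lemma KoszulExact.of_injective {M : Type*} [AddCommGroup M] [Module R M] {𝓜 : ℤ → AddSubgroup M}
    {𝓐 : ℤ → AddSubgroup A} (φ : M →ₗ[R] A) (hφ : Function.Injective φ)
    (h1 : ∀ e, ∀ m ∈ 𝓜 e, φ m ∈ 𝓐 e) (h2 : ∀ e, ∀ c ∈ 𝓐 e, ∃ m ∈ 𝓜 e, φ m = c) {q : ℕ} {a : ℤ}
    (h : KoszulExact x d 𝓐 q a) : KoszulExact x d 𝓜 q a := by
  intro f hf hf0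
  obtain ⟨g, hg, hgf⟩ := h _ (koszulChains_map φ (map_zero φ) h1 hf)
    (by rw [koszulDiff_comp, hf0]; funext J; simp)
  choose g' hg1 hg2 using fun J => h2 _ _ (hg J).1
  refine ⟨g', fun J => ⟨hg1 J, fun hJ => hφ ?_⟩, ?_⟩
  · rw [hg2, (hg J).2 hJ, map_zero]
  · funext J
    apply hφ
    rw [← congrFun (koszulDiff_comp x φ g') J, ← congrFun hgf J]
    simp only [hg2]

end Zigzag

/-! ### The Čech complex as coefficients of Koszul chains. -/

section Cech

variable {k : Type u} [Field k] {n : ℕ} {M : Type v} [AddCommGroup M] [Module (CoxRing k n) M]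

lemma cechRestrict_mk {I J : Finset (Fin (n + 1))} (h : I ⊆ J) (m : M) (s : varSubmonoid k I) :
    cechRestrict k M h (LocalizedModule.mk m s) =
      LocalizedModule.mk m ⟨s.1, varSubmonoid_mono k h s.2⟩ := by
  let s' : varSubmonoid k J := ⟨s.1, varSubmonoid_mono k h s.2⟩
  apply IsLocalizedModule.smul_injective (LocalizedModule.mkLinearMap (varSubmonoid k J) M) s'
  change s.1 • cechRestrict k M h (LocalizedModule.mk m s) = s.1 • LocalizedModule.mk m s'
  rw [← map_smul, LocalizedModule.smul'_mk, LocalizedModule.smul'_mk]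
  change cechRestrict k M h (LocalizedModule.mk (s • m) s) = LocalizedModule.mk (s' • m) s'
  rw [LocalizedModule.mk_cancel, LocalizedModule.mk_cancel]
  exact LinearMap.congr_fun (LocalizedModule.lift_comp (varSubmonoid k I)
    (LocalizedModule.mkLinearMap (varSubmonoid k J) M) fun s =>
      IsLocalizedModule.map_units (LocalizedModule.mkLinearMap (varSubmonoid k J) M)
        ⟨s.1, varSubmonoid_mono k h s.2⟩) m

lemma cechRestrict_cechRestrict {I J K : Finset (Fin (n + 1))} (h : I ⊆ J) (h' : J ⊆ K)
    (y : CechLoc k M I) :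
    cechRestrict k M h' (cechRestrict k M h y) = cechRestrict k M (h.trans h') y := by
  induction y using LocalizedModule.induction_on with
  | h m s => rw [cechRestrict_mk, cechRestrict_mk, cechRestrict_mk]

lemma cechRestrict_congr (f : ∀ I : Finset (Fin (n + 1)), CechLoc k M I)
    {I I' J : Finset (Fin (n + 1))} (hI : I = I') (h : I ⊆ J) (h' : I' ⊆ J) :
    cechRestrict k M h (f I) = cechRestrict k M h' (f I') := by
  subst hI; rfl

lemma cechDifferential_apply (f : ∀ I : Finset (Fin (n + 1)), CechLoc k M I)
    (J : Finset (Fin (n + 1))) : cechDifferential k M f J =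
      ∑ j ∈ J, (koszulSign J j : CoxRing k n) • cechRestrict k M (J.erase_subset j) (f (J.erase j)) := by
  simp only [cechDifferential, LinearMap.pi_apply, LinearMap.sum_apply, LinearMap.smul_apply,
    LinearMap.comp_apply, LinearMap.proj_apply]
  refine Finset.sum_congr rfl fun j _ => ?_
  rw [koszulSign]
  push_cast
  rfl

lemma koszulSign_erase_swap {σ : Type*} [LinearOrder σ] {J : Finset σ} {j l : σ} (hj : j ∈ J)
    (hl : l ∈ J) (hjl : j ≠ l) :
    koszulSign J j * koszulSign (J.erase j) l = -(koszulSign J l * koszulSign (J.erase l) j) := by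
  obtain ⟨K, hjK, rfl⟩ : ∃ K, j ∉ K ∧ insert j K = J := ⟨J.erase j, by simp, Finset.insert_erase hj⟩
  have hlK : l ∈ K := by simpa [Ne.symm hjl] using hl
  obtain ⟨L, hlL, rfl⟩ : ∃ L, l ∉ L ∧ insert l L = K := ⟨K.erase l, by simp, Finset.insert_erase hlK⟩
  have hjL : j ∉ L := fun h => hjK (by simp [h])
  have h := koszulSign_swap hjL hlL hjl
  rw [Finset.erase_insert hjK, koszulSign_insert_of_le (j := j) le_rfl,
    koszulSign_insert_of_le (J := L) le_rfl, Finset.insert_comm j l,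
    Finset.erase_insert (by simp [hlL, Ne.symm hjl]),
    koszulSign_insert_of_le (J := insert j L) le_rfl, koszulSign_insert_of_le (J := L) le_rfl]
  linear_combination h

lemma cechDifferential_cechDifferential (f : ∀ I : Finset (Fin (n + 1)), CechLoc k M I) :
    cechDifferential k M (cechDifferential k M f) = 0 := by
  funext J
  simp only [cechDifferential_apply, map_sum, Finset.smul_sum, Pi.zero_apply, map_smul,
    cechRestrict_cechRestrict, smul_smul, ← Int.cast_mul]
  rw [Finset.sum_sigma']
  refine Finset.sum_involution (fun p _ => ⟨p.2, p.1⟩) ?_ ?_ ?_ (fun _ _ => rfl)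
  · rintro ⟨j, l⟩ h
    simp only [Finset.mem_sigma, Finset.mem_erase] at h
    simp only
    rw [koszulSign_erase_swap h.1 h.2.2 (Ne.symm h.2.1), cechRestrict_congr f
      (Finset.erase_right_comm (s := J) (a := j) (b := l)) _
      (((J.erase l).erase_subset j).trans (J.erase_subset l)), Int.cast_neg, neg_smul, neg_add_cancel]
  · rintro ⟨j, l⟩ h _ h'
    simp only [Finset.mem_sigma, Finset.mem_erase] at h
    simp only [Sigma.mk.injEq] at h'
    exact h.2.1 h'.1
  · rintro ⟨j, l⟩ h
    simp only [Finset.mem_sigma, Finset.mem_erase] at h ⊢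
    exact ⟨h.2.2, Ne.symm h.2.1, h.1⟩

variable {d : Fin (n + 1) → ℤ} (𝓜 : ℤ → AddSubgroup M)
  [SetLike.GradedSMul (coxGrading k d) 𝓜]

lemma cechRestrict_mem {I J : Finset (Fin (n + 1))} (h : I ⊆ J) {e : ℤ} {y : CechLoc k M I}
    (hy : y ∈ cechLocDegree k d 𝓜 I e) : cechRestrict k M h y ∈ cechLocDegree k d 𝓜 J e := by
  obtain ⟨a, s, m, hs, hm, rfl⟩ := hy
  rw [cechRestrict_mk]
  exact ⟨a, _, m, hs, hm, rfl⟩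

lemma cechDifferential_mem {p : ℕ} {e : ℤ} {f : ∀ I : Finset (Fin (n + 1)), CechLoc k M I}
    (hf : f ∈ cechCochains k d 𝓜 p e) : cechDifferential k M f ∈ cechCochains k d 𝓜 (p + 1) e := by
  intro J
  rw [cechDifferential_apply]
  constructor
  · refine sum_mem fun j _ => ?_
    have h := cechRestrict_mem 𝓜 (J.erase_subset j) (hf (J.erase j)).1
    rcases neg_one_pow_eq_or ℤ (J.filter (· < j)).card with h' | h'
    · rwa [koszulSign, h', Int.cast_one, one_smul]
    · rw [koszulSign, h', Int.cast_neg, Int.cast_one, neg_smul, one_smul]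
      exact neg_mem h
  · intro h
    refine Finset.sum_eq_zero fun j hj => ?_
    rw [(hf _).2, map_zero, smul_zero]
    rw [Finset.card_erase_of_mem hj]
    have := Finset.card_pos.2 ⟨j, hj⟩
    omega

lemma cechLocDegree_isGradedBy (I : Finset (Fin (n + 1))) :
    IsGradedBy (X : _ → CoxRing k n) d (cechLocDegree k d 𝓜 I) := by
  rintro j e _ ⟨a, s, m, hs, hm, rfl⟩
  refine ⟨a, s, (X j : CoxRing k n) • m, hs, ?_, LocalizedModule.smul'_mk _ _ _⟩
  have := isGradedBy_of_gradedSMul (k := k) (d := d) 𝓜 j _ _ hm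
  rwa [add_right_comm] at this

lemma cechCochains_isGradedBy (p : ℕ) :
    IsGradedBy (X : _ → CoxRing k n) d (cechCochains k d 𝓜 p) :=
  fun j e f hf I => ⟨cechLocDegree_isGradedBy 𝓜 I j e _ (hf I).1, fun h => by
    rw [Pi.smul_apply, (hf I).2 h, smul_zero]⟩

lemma koszulExact_cechLocDegree {I : Finset (Fin (n + 1))} (hI : I.Nonempty) (q : ℕ) (a : ℤ) :
    KoszulExact (X : _ → CoxRing k n) d (cechLocDegree k d 𝓜 I) q a := by
  obtain ⟨i, hi⟩ := hI
  let t : varSubmonoid k I := ⟨X i, Submonoid.subset_closure ⟨i, by simpa using hi, rfl⟩⟩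
  have ht : IsUnit (algebraMap (CoxRing k n) (Module.End (CoxRing k n) (CechLoc k M I)) t) :=
    IsLocalizedModule.map_units (LocalizedModule.mkLinearMap (varSubmonoid k I) M) t
  obtain ⟨U, hU⟩ := ht
  have hU1 : ∀ y, (X i : CoxRing k n) • (U⁻¹).1 y = y := by
    intro y
    have := LinearMap.congr_fun U.mul_inv y
    rwa [hU] at this
  have hU2 : ∀ y, (U⁻¹).1 ((X i : CoxRing k n) • y) = y := fun y => by rw [map_smul, hU1]
  refine koszulExact_of_invertible (i := i) (U⁻¹).1 hU1 ?_ q a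
  rintro e _ ⟨b, s, m, hs, hm, rfl⟩
  -- Writing the fraction as `x_i` times another one shows that the inverse only enlarges the
  -- denominator, which gives its degree.
  have h1 : LocalizedModule.mk m s = (X i : CoxRing k n) • LocalizedModule.mk m (t * s) := by
    rw [LocalizedModule.smul'_mk]
    exact (LocalizedModule.mk_cancel_common_left t s m).symm
  rw [h1, hU2]
  refine ⟨d i + b, t * s, m, IsWeightedHomogeneous.mul (isWeightedHomogeneous_X k d i) hs, ?_, rfl⟩
  rwa [show e - d i + (d i + b) = e + b by ring]

lemma koszulExact_cechCochains (p q : ℕ) (a : ℤ) :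
    KoszulExact (X : _ → CoxRing k n) d (cechCochains k d 𝓜 (p + 1)) q a := by
  intro f hf hf0
  have hex : ∀ I : Finset (Fin (n + 1)), ∃ g ∈ koszulChains d (cechLocDegree k d 𝓜 I) (q + 1) a,
      (I.card ≠ p + 1 → g = 0) ∧ koszulDiff (X : _ → CoxRing k n) (CechLoc k M I) g = fun J => f J I := by
    intro I
    by_cases hI : I.card = p + 1
    · obtain ⟨g, hg, hgf⟩ := koszulExact_cechLocDegree 𝓜 (I := I)
        (Finset.card_pos.1 (by omega)) q a (fun J => f J I)
        (fun J => ⟨((hf J).1 I).1, fun h => congrFun ((hf J).2 h) I⟩)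
        ((koszulDiff_comp X (LinearMap.proj I : (∀ I, CechLoc k M I) →ₗ[CoxRing k n] _) f).trans
          (by rw [hf0]; rfl))
      exact ⟨g, hg, fun h => absurd hI h, hgf⟩
    · exact ⟨0, zero_mem _, fun _ => rfl, by
        rw [map_zero]; funext J; exact (((hf J).1 I).2 hI).symm⟩
  choose g hg1 hg2 hg3 using hex
  refine ⟨fun J I => g I J, fun J => ⟨fun I => ⟨(hg1 I J).1, fun h => congrFun (hg2 I h) J⟩,
    fun h => funext fun I => (hg1 I J).2 h⟩, ?_⟩
  funext J I
  rw [← congrFun (hg3 I) J]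
  exact (congrFun (koszulDiff_comp X (LinearMap.proj I : (∀ I, CechLoc k M I) →ₗ[CoxRing k n] _)
    (fun J I => g I J)) J).symm

/-- The zeroth Čech term is `M` itself: only `I = ∅` contributes, and nothing is inverted there. -/
lemma koszulExact_of_cechCochains_zero {q : ℕ} {a : ℤ}
    (h : KoszulExact (X : _ → CoxRing k n) d (cechCochains k d 𝓜 0) q a) :
    KoszulExact (X : _ → CoxRing k n) d 𝓜 q a := by
  have hS : ∀ s : varSubmonoid k (∅ : Finset (Fin (n + 1))), s = 1 := by
    rintro ⟨s, hs⟩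
    exact Subtype.ext (by simpa [varSubmonoid] using hs)
  refine h.of_injective ((LinearMap.single (CoxRing k n) (fun I => CechLoc k M I) ∅).comp
    (LocalizedModule.mkLinearMap (varSubmonoid k ∅) M)) ?_ ?_ ?_
  · intro m m' hm
    have h1 := congrFun hm ∅
    simp only [LinearMap.comp_apply, LinearMap.single_apply, Pi.single_eq_same,
      LocalizedModule.mkLinearMap_apply, LocalizedModule.mk_eq] at h1
    obtain ⟨u, hu⟩ := h1
    rw [hS u] at hu
    simpa using hu
  · intro e m hm I
    by_cases hI : I = ∅
    · subst hI
      simp only [LinearMap.comp_apply, LinearMap.single_apply, Pi.single_eq_same,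
        Finset.card_empty, ne_eq, not_true_eq_false, false_imp_iff, and_true]
      exact ⟨0, 1, m, isWeightedHomogeneous_one k d, by rwa [add_zero], rfl⟩
    · simp only [LinearMap.comp_apply, LinearMap.single_apply, Pi.single_eq_of_ne hI]
      exact ⟨zero_mem _, fun _ => trivial⟩
  · intro e c hc
    obtain ⟨a, s, m, hs, hm, hcs⟩ := (hc ∅).1
    obtain rfl := hS s
    obtain rfl : a = 0 :=
      IsWeightedHomogeneous.inj_right one_ne_zero hs (isWeightedHomogeneous_one k d)
    rw [add_zero] at hm
    refine ⟨m, hm, ?_⟩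
    funext I
    by_cases hI : I = ∅
    · subst hI
      simp [hcs]
    · rw [(hc I).2 (by simpa using hI)]
      simp [Pi.single_eq_of_ne hI]

variable {𝓜}

lemma mem_shiftedTerm_of_subsingleton {p : ℕ} {e : ℤ} (h : Subsingleton (LocalCohomology k d 𝓜 p e))
    {c : ∀ I : Finset (Fin (n + 1)), CechLoc k M I} (hc : c ∈ cechCochains k d 𝓜 p e)
    (hc0 : cechDifferential k M c = 0) :
    ∃ b ∈ shiftedTerm (cechCochains k d 𝓜) p e, cechDifferential k M b = c := by
  have hmem : c ∈ cechCoboundaries k d 𝓜 p e := by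
    rw [QuotientAddGroup.subsingleton_iff] at h
    have : (⟨c, hc, hc0⟩ : cechCocycles k d 𝓜 p e) ∈
        (cechCoboundaries k d 𝓜 p e).addSubgroupOf (cechCocycles k d 𝓜 p e) := by
      rw [h]; trivial
    exact this
  cases p with
  | zero => exact ⟨0, zero_mem _, by rw [map_zero]; exact (AddSubgroup.mem_bot.1 hmem).symm⟩
  | succ p =>
    obtain ⟨b, hb, hbc⟩ := hmem
    exact ⟨b, hb, hbc⟩

end Cech

/-! ### Inequalities between sums of weights. -/

section Weights

variable {n : ℕ} {d : Fin (n + 1) → ℤ}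

lemma topWeight_of_le {i : ℕ} (hi : i ≤ n + 1) : topWeight d i =
    ∑ j ∈ Finset.univ.filter (fun j : Fin (n + 1) => n + 1 ≤ j.val + i), d j := by
  rw [topWeight, if_neg (by omega), if_neg (by omega)]
  refine Finset.sum_congr ?_ fun _ _ => rfl
  ext j
  simp only [Finset.mem_filter, Finset.mem_univ, true_and]
  omega

/-- Exchange argument against the top segment `T` of the same size, with least index `c`: `J \ T`
and `T \ J` are equinumerous, and `d c` separates their weights. -/
lemma sum_le_topWeight (hd : Monotone d) (J : Finset (Fin (n + 1))) :
    ∑ j ∈ J, d j ≤ topWeight d J.card := by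
  have hJ : J.card ≤ n + 1 := by simpa using Finset.card_le_univ J
  rw [topWeight_of_le hJ]
  rcases Nat.eq_zero_or_pos J.card with h0 | h0
  -- The empty set is treated apart because `T` then has no least index.
  · rw [h0, Finset.card_eq_zero.1 h0, Finset.filter_false_of_mem fun j _ => by omega]
  set T := Finset.univ.filter (fun j : Fin (n + 1) => n + 1 ≤ j.val + J.card) with hT
  let c : Fin (n + 1) := ⟨n + 1 - J.card, by omega⟩
  have hTc : T = Finset.Ici c := by
    ext j
    simp only [hT, Finset.mem_filter, Finset.mem_univ, true_and, Finset.mem_Ici, Fin.le_def, c]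
    omega
  have hcard : T.card = J.card := by
    rw [hTc, Fin.card_Ici]
    simp only [c]
    omega
  have h1 : ∑ j ∈ J \ T, d j ≤ (J \ T).card • d c := by
    refine Finset.sum_le_card_nsmul _ _ _ fun j hj => hd ?_
    rw [Finset.mem_sdiff, hTc, Finset.mem_Ici, not_le] at hj
    exact hj.2.le
  have h2 : (T \ J).card • d c ≤ ∑ j ∈ T \ J, d j := by
    refine Finset.card_nsmul_le_sum _ _ _ fun j hj => hd ?_
    rw [Finset.mem_sdiff, hTc, Finset.mem_Ici] at hj
    exact hj.1
  have h3 : (J \ T).card = (T \ J).card := Finset.card_sdiff_comm hcard.symm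
  have h4 := Finset.sum_inter_add_sum_sdiff J T d
  have h5 := Finset.sum_inter_add_sum_sdiff T J d
  rw [Finset.inter_comm] at h5
  rw [h3] at h1
  linarith

/-- For `p ≥ 1`, split `J` into `p - 1` and `i + 1` indices. For `p = 0` the convention `w^{-1} =
-1` requires a gain of one: an index outside `J` has weight at least one, and if `J` is everything,
`w^{n+2} = w^{n+1} + 1` supplies it. -/
lemma sum_le_topWeight_add (hd_pos : ∀ i, 0 < d i) (hd : Monotone d) {i p : ℕ}
    {J : Finset (Fin (n + 1))} (hJ : J.card = i + p) :
    ∑ j ∈ J, d j ≤ topWeight d ((i : ℤ) + 1) + topWeight d ((p : ℤ) - 1) := by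
  have hle : i + p ≤ n + 1 := by rw [← hJ]; simpa using Finset.card_le_univ J
  cases p with
  | zero =>
    rw [show topWeight d (((0 : ℕ) : ℤ) - 1) = -1 by simp [topWeight]]
    by_cases hi : i = n + 1
    · have h1 : topWeight d ((i : ℤ) + 1) = (∑ j, d j) + 1 := by
        rw [topWeight, if_neg (by omega), if_pos (by omega)]
      have h2 : J = Finset.univ := Finset.eq_univ_of_card J (by simpa using hJ.trans (by omega))
      rw [h1, h2]
      simp
    · obtain ⟨j, hj⟩ : ∃ j, j ∉ J := by
        by_contra! h
        have : J = Finset.univ := Finset.eq_univ_of_forall h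
        rw [this] at hJ
        simp at hJ
        omega
      have h1 := sum_le_topWeight hd (insert j J)
      rw [Finset.sum_insert hj, Finset.card_insert_of_notMem hj, hJ] at h1
      have := hd_pos j
      push_cast at h1
      simp only [add_zero] at h1
      linarith
  | succ p =>
    obtain ⟨J', hJ', hcard⟩ := Finset.exists_subset_card_eq (s := J) (n := p) (by omega)
    have h1 := sum_le_topWeight hd J'
    have h2 := sum_le_topWeight hd (J \ J')
    rw [Finset.card_sdiff_of_subset hJ', hJ, hcard, show i + (p + 1) - p = i + 1 by omega] at h2
    rw [hcard] at h1
    have h3 := Finset.sum_sdiff hJ' (f := d)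
    push_cast at h2 ⊢
    rw [add_sub_cancel_right]
    linarith

end Weights

/-- The Koszul homology of a `0`-regular module vanishes in high degrees. -/
lemma IsZeroRegular.koszulExact {k : Type u} [Field k] {n : ℕ} {M : Type v} [AddCommGroup M]
    [Module (CoxRing k n) M] {d : Fin (n + 1) → ℤ} {𝓜 : ℤ → AddSubgroup M}
    [SetLike.GradedSMul (coxGrading k d) 𝓜] (hreg : IsZeroRegular k d 𝓜)
    (hd_pos : ∀ i, 0 < d i) (hd_mono : Monotone d) {i : ℕ} {a : ℤ}
    (ha : topWeight d ((i : ℤ) + 1) ≤ a) : KoszulExact (X : _ → CoxRing k n) d 𝓜 i a := by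
  apply koszulExact_of_cechCochains_zero
  refine koszulExact_of_resolution (cechDifferential k M) (cechCochains k d 𝓜)
    (fun p e c hc => cechDifferential_mem 𝓜 hc) cechDifferential_cechDifferential
    (cechCochains_isGradedBy 𝓜) (koszulExact_cechCochains 𝓜) ?_
  intro p J hJ c hc hc0
  have hle : i + p ≤ n + 1 := by rw [← hJ]; simpa using Finset.card_le_univ J
  refine mem_shiftedTerm_of_subsingleton (hreg p (by omega) _ ?_) hc hc0
  have := sum_le_topWeight_add hd_pos hd_mono hJ
  linarith

/-! ### Dimension shifting along a minimal cover. -/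

section Minimal

variable {k : Type u} [Field k] {n : ℕ} {d : Fin (n + 1) → ℤ} {ι : Type w} {a : ι → ℤ}
  {A : Type*} [AddCommGroup A] [Module (CoxRing k n) A] {𝓐 : ℤ → AddSubgroup A}

lemma koszulDiff_mem_irrelevantIdeal (f : Finset (Fin (n + 1)) → (ι →₀ CoxRing k n))
    (J : Finset (Fin (n + 1))) (b : ι) :
    koszulDiff (X : _ → CoxRing k n) _ f J b ∈ irrelevantIdeal k n := by
  rw [koszulDiff_apply, Finsupp.finsetSum_apply]
  refine sum_mem fun j _ => ?_
  rw [Finsupp.smul_apply, Finsupp.smul_apply, smul_eq_mul]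
  exact zsmul_mem (Ideal.mul_mem_right _ _ (Ideal.subset_span (Set.mem_range_self j))) _

lemma single_one_mem_freeDegree (b : ι) : Finsupp.single b (1 : CoxRing k n) ∈
    freeDegree k d a (a b) :=
  single_mem_freeDegree (by rw [sub_self]; exact isWeightedHomogeneous_one k d)

lemma single_one_notMem (b : ι) : ¬ ∀ b', (Finsupp.single b (1 : CoxRing k n)) b' ∈
    irrelevantIdeal k n := by
  intro h
  have := mem_irrelevantIdeal.1 (h b)
  simp at this

/-- For `0 → N → F → A → 0` this is injectivity of the connecting map `Tor_{q+1}(A, k) → Tor_q(N,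
k)` read backwards: `Tor_q(N, k) → Tor_q(F, k)` is zero, for `q = 0` because `N ⊆ B F`, so vanishing
for `A` forces vanishing for `N`. -/
lemma KoszulExact.syzygy {φ : (ι →₀ CoxRing k n) →ₗ[CoxRing k n] A}
    {𝓝 : ℤ → AddSubgroup (ι →₀ CoxRing k n)}
    (h𝓝 : ∀ e f, f ∈ 𝓝 e ↔ f ∈ freeDegree k d a e ∧ φ f = 0)
    (hφ : ∀ e, ∀ f ∈ freeDegree k d a e, φ f ∈ 𝓐 e)
    (hsurj : ∀ e, ∀ m ∈ 𝓐 e, ∃ f ∈ freeDegree k d a e, φ f = m)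
    (hB : ∀ f, φ f = 0 → ∀ b, f b ∈ irrelevantIdeal k n) {q : ℕ} {e : ℤ}
    (h : KoszulExact (X : _ → CoxRing k n) d 𝓐 (q + 1) e) :
    KoszulExact (X : _ → CoxRing k n) d 𝓝 q e := by
  intro z hz hz0
  have hz' : z ∈ koszulChains d (freeDegree k d a) q e :=
    fun J => ⟨((h𝓝 _ _).1 (hz J).1).1, (hz J).2⟩
  obtain ⟨y, hy, rfl⟩ := exists_koszulDiff_eq_of_free hz' hz0
    (hB _ ((h𝓝 _ _).1 (hz ∅).1).2)
  obtain ⟨w, hw, hwy⟩ := h _ (koszulChains_map φ (map_zero φ) hφ hy) (by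
    rw [koszulDiff_comp]
    exact funext fun J => ((h𝓝 _ _).1 (hz J).1).2)
  choose w' hw1 hw2 using fun J => hsurj _ _ (hw J).1
  -- On sets of the wrong size the chosen lift of `0` may be nonzero, so it is cut off.
  let w'' : Finset (Fin (n + 1)) → (ι →₀ CoxRing k n) := fun J =>
    if J.card = q + 1 + 1 then w' J else 0
  have hw'' : w'' ∈ koszulChains d (freeDegree k d a) (q + 1 + 1) e := fun J => by
    by_cases hJ : J.card = q + 1 + 1
    · simp only [w'', if_pos hJ]
      exact ⟨hw1 J, fun h => absurd hJ h⟩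
    · simp only [w'', if_neg hJ]
      exact ⟨zero_mem _, fun _ => trivial⟩
  have hφw : (fun J => φ (w'' J)) = w := by
    funext J
    by_cases hJ : J.card = q + 1 + 1
    · simp only [w'', if_pos hJ, hw2]
    · simp only [w'', if_neg hJ, map_zero, (hw J).2 hJ]
  have hg : y - koszulDiff (X : _ → CoxRing k n) _ w'' ∈ koszulChains d (freeDegree k d a) (q + 1) e :=
    sub_mem hy (koszulDiff_mem (isGradedBy_of_gradedSMul _) hw'')
  refine ⟨y - koszulDiff (X : _ → CoxRing k n) _ w'', fun J => ⟨(h𝓝 _ _).2 ⟨(hg J).1, ?_⟩, (hg J).2⟩, ?_⟩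
  · rw [Pi.sub_apply, map_sub, ← congrFun (koszulDiff_comp X φ w'') J, hφw, hwy, sub_self]
  · rw [map_sub, koszulDiff_koszulDiff, sub_zero]

/-- Exactness at place `0` says `A_e = (B A)_e`. A basis vector of degree `e` would then agree,
modulo the kernel and hence modulo `B F`, with an element of `B F`, which its coefficient `1`
forbids. -/
lemma KoszulExact.shift_ne {φ : (ι →₀ CoxRing k n) →ₗ[CoxRing k n] A}
    (hφ : ∀ e, ∀ f ∈ freeDegree k d a e, φ f ∈ 𝓐 e)
    (hsurj : ∀ e, ∀ m ∈ 𝓐 e, ∃ f ∈ freeDegree k d a e, φ f = m)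
    (hB : ∀ f, φ f = 0 → ∀ b, f b ∈ irrelevantIdeal k n) {e : ℤ}
    (h : KoszulExact (X : _ → CoxRing k n) d 𝓐 0 e) (b : ι) : a b ≠ e := by
  rintro rfl
  obtain ⟨g, hg, hgf⟩ := h (Pi.single ∅ (φ (Finsupp.single b 1))) (fun J => by
      by_cases hJ : J = ∅
      · subst hJ
        simpa using hφ _ _ (single_one_mem_freeDegree b)
      · rw [Pi.single_eq_of_ne hJ]
        exact ⟨zero_mem _, fun _ => rfl⟩) (by
      funext J
      rw [koszulDiff_apply]
      refine Finset.sum_eq_zero fun j _ => ?_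
      rw [Pi.single_eq_of_ne (Finset.insert_ne_empty j J), smul_zero, smul_zero])
  choose g' hg1 hg2 using fun J => hsurj _ _ (hg J).1
  have h0 : φ (Finsupp.single b 1 - koszulDiff (X : _ → CoxRing k n) _ g' ∅) = 0 := by
    rw [map_sub, ← congrFun (koszulDiff_comp X φ g') ∅]
    simp only [hg2, hgf, Pi.single_eq_same, sub_self]
  refine single_one_notMem (k := k) (n := n) b fun b' => ?_
  have h1 := add_mem (hB _ h0 b') (koszulDiff_mem_irrelevantIdeal g' ∅ b')
  rwa [← Finsupp.add_apply, sub_add_cancel] at h1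

end Minimal

/-! ### Koszul homology along a minimal resolution. -/

namespace GradedFreeResolution

variable {k : Type u} [Field k] {n : ℕ} {d : Fin (n + 1) → ℤ}
    {M : Type v} [AddCommGroup M] [Module (CoxRing k n) M] {𝓜 : ℤ → AddSubgroup M}
    (F : GradedFreeResolution.{u, v, w} k d 𝓜)

/-- The graded pieces of the image of `F_{i+1} → F_i`. -/
noncomputable def boundaries (i : ℕ) (e : ℤ) : AddSubgroup (F.ι i →₀ CoxRing k n) :=
  freeDegree k d (F.shift i) e ⊓ (LinearMap.range (F.diff i)).toAddSubgroup

variable {F}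

lemma exists_aug_eq [DirectSum.Decomposition 𝓜] {e : ℤ} {m : M} (hm : m ∈ 𝓜 e) :
    ∃ f ∈ freeDegree k d (F.shift 0) e, F.aug f = m := by
  obtain ⟨f, rfl⟩ := F.aug_surjective m
  refine ⟨DirectSum.decompose (freeDegree k d (F.shift 0)) f e, SetLike.coe_mem _, ?_⟩
  have := decompose_map (freeDegree k d (F.shift 0)) 𝓜 F.aug.toAddMonoidHom F.aug_mem f e
  exact this.symm.trans (DirectSum.decompose_of_mem_same _ hm)

lemma exists_diff_eq {i : ℕ} {e : ℤ} {m : F.ι i →₀ CoxRing k n} (hm : m ∈ F.boundaries i e) :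
    ∃ f ∈ freeDegree k d (F.shift (i + 1)) e, F.diff i f = m := by
  obtain ⟨hm, f, rfl⟩ := hm
  refine ⟨DirectSum.decompose (freeDegree k d (F.shift (i + 1))) f e, SetLike.coe_mem _, ?_⟩
  have := decompose_map (freeDegree k d (F.shift (i + 1))) (freeDegree k d (F.shift i))
    (F.diff i).toAddMonoidHom (F.diff_mem i) f e
  exact this.symm.trans (DirectSum.decompose_of_mem_same _ hm)

lemma diff_mem_boundaries (i : ℕ) (e : ℤ) (f) (hf : f ∈ freeDegree k d (F.shift (i + 1)) e) :
    F.diff i f ∈ F.boundaries i e := ⟨F.diff_mem i e f hf, f, rfl⟩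

lemma IsMinimal.mem_of_aug_eq_zero (hF : F.IsMinimal) (f) (hf : F.aug f = 0) (b) :
    f b ∈ irrelevantIdeal k n := by
  obtain ⟨g, rfl⟩ := (F.exact_zero f).1 hf
  exact hF 0 g b

lemma IsMinimal.mem_of_diff_eq_zero (hF : F.IsMinimal) {i : ℕ} (f) (hf : F.diff i f = 0) (b) :
    f b ∈ irrelevantIdeal k n := by
  obtain ⟨g, rfl⟩ := (F.exact_succ i f).1 hf
  exact hF (i + 1) g b

lemma IsMinimal.koszulExact_boundaries [DirectSum.Decomposition 𝓜] (hF : F.IsMinimal) (i : ℕ) :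
    ∀ {q : ℕ} {e : ℤ}, KoszulExact (X : _ → CoxRing k n) d 𝓜 (q + 1 + i) e →
      KoszulExact (X : _ → CoxRing k n) d (F.boundaries i) q e := by
  induction i with
  | zero =>
    intro q e h
    exact KoszulExact.syzygy (fun e f => and_congr_right fun _ => (F.exact_zero f).symm) F.aug_mem
      (fun e m => exists_aug_eq) hF.mem_of_aug_eq_zero h
  | succ i ih =>
    intro q e h
    refine KoszulExact.syzygy (fun e f => and_congr_right fun _ => (F.exact_succ i f).symm)
      (diff_mem_boundaries i) (fun e m => exists_diff_eq) hF.mem_of_diff_eq_zero (ih ?_)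
    rwa [show q + 1 + 1 + i = q + 1 + (i + 1) by ring]

/-- The degrees of the basis elements of the `i`-th term of a minimal graded free resolution are
degrees where the `i`-th Koszul homology does not vanish. -/
lemma IsMinimal.shift_ne [DirectSum.Decomposition 𝓜] (hF : F.IsMinimal) {i : ℕ} {e : ℤ}
    (h : KoszulExact (X : _ → CoxRing k n) d 𝓜 i e) (b : F.ι i) : F.shift i b ≠ e := by
  cases i with
  | zero => exact h.shift_ne F.aug_mem (fun e m => exists_aug_eq) hF.mem_of_aug_eq_zero b
  | succ i =>
    refine KoszulExact.shift_ne (diff_mem_boundaries i) (fun e m => exists_diff_eq)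
      hF.mem_of_diff_eq_zero (hF.koszulExact_boundaries i ?_) b
    rwa [show 0 + 1 + i = i + 1 by ring]

lemma IsMinimal.isEmpty [DirectSum.Decomposition 𝓜] (hF : F.IsMinimal) {i : ℕ} (hi : n + 1 < i) :
    IsEmpty (F.ι i) :=
  -- Beyond the number of variables all Koszul chains vanish, so exactness is free in every degree,
  -- in particular in that of `b`.
  ⟨fun b => hF.shift_ne (fun f hf _ => ⟨0, zero_mem _, by
    rw [koszulChains_eq_zero (by simpa using hi) hf, map_zero]⟩) b rfl⟩

end GradedFreeResolution

/-! ### Consequences of the positivity of the weights. -/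

section Positive

variable {k : Type u} [Field k] {n : ℕ} {d : Fin (n + 1) → ℤ}

lemma weight_nonneg (hd : ∀ i, 0 < d i) (s : Fin (n + 1) →₀ ℕ) : 0 ≤ Finsupp.weight d s := by
  rw [Finsupp.weight_apply]
  exact Finset.sum_nonneg fun i _ => nsmul_nonneg (hd i).le _

lemma weight_pos (hd : ∀ i, 0 < d i) {s : Fin (n + 1) →₀ ℕ} (hs : s ≠ 0) :
    0 < Finsupp.weight d s := by
  rw [Finsupp.weight_apply]
  refine Finset.sum_pos (fun i hi => nsmul_pos (hd i) ?_) (Finsupp.support_nonempty_iff.2 hs)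
  simpa using hi

lemma eq_bot_of_generatedInDegreeGE (hd : ∀ i, 0 < d i) {M : Type v} [AddCommGroup M]
    [Module (CoxRing k n) M] {𝓜 : ℤ → AddSubgroup M} [DirectSum.Decomposition 𝓜]
    [SetLike.GradedSMul (coxGrading k d) 𝓜] {c : ℤ} (h : GeneratedInDegreeGE k n 𝓜 c) {e : ℤ}
    (he : e < c) : 𝓜 e = ⊥ := by
  have key : ∀ m : M, (DirectSum.decompose 𝓜 m e : M) = 0 := by
    intro m
    have hm : m ∈ (Submodule.span (CoxRing k n) {m : M | ∃ e, c ≤ e ∧ m ∈ 𝓜 e}) := by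
      rw [h]; trivial
    rw [← Submodule.mem_toAddSubmonoid, Submodule.span_eq_closure] at hm
    induction hm using AddSubmonoid.closure_induction with
    | zero => simp
    | add x y _ _ hx hy => simp [DirectSum.decompose_add, hx, hy]
    | mem x hx =>
      obtain ⟨p, -, m, ⟨e', he', hm⟩, rfl⟩ := hx
      simp only
      induction p using MvPolynomial.induction_on' with
      | monomial s r =>
        have hs : monomial s r • m ∈ 𝓜 (Finsupp.weight d s +ᵥ e') :=
          SetLike.GradedSMul.smul_mem (A := coxGrading k d)
            (isWeightedHomogeneous_monomial d s r rfl) hm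
        refine DirectSum.decompose_of_mem_ne _ hs ?_
        have := weight_nonneg hd s
        rw [vadd_eq_add]
        omega
      | add p q hp hq => simp [add_smul, DirectSum.decompose_add, hp, hq]
  rw [eq_bot_iff]
  intro m hm
  rw [AddSubgroup.mem_bot, ← key m, DirectSum.decompose_of_mem_same _ hm]

namespace GradedFreeResolution

variable {M : Type v} [AddCommGroup M] [Module (CoxRing k n) M] {𝓜 : ℤ → AddSubgroup M}
    {F : GradedFreeResolution.{u, v, w} k d 𝓜}

/-- A nonzero entry of a minimal differential has positive degree, so degrees rise by at least one
per step. A basis vector of too small a degree would map to zero, hence lie in `B F_i` by exactness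
and minimality. -/
lemma IsMinimal.le_shift (hF : F.IsMinimal) (hd : ∀ i, 0 < d i) (h𝓜 : ∀ e < 0, 𝓜 e = ⊥) (i : ℕ) :
    ∀ b, (i : ℤ) ≤ F.shift i b := by
  induction i with
  | zero =>
    intro b
    by_contra! hb
    refine single_one_notMem (k := k) (n := n) b (hF.mem_of_aug_eq_zero _ ?_)
    have := F.aug_mem _ _ (single_one_mem_freeDegree b)
    rwa [h𝓜 _ (by simpa using hb), AddSubgroup.mem_bot] at this
  | succ i ih =>
    intro b
    by_contra! hb
    refine single_one_notMem (k := k) (n := n) b (hF.mem_of_diff_eq_zero _ ?_)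
    ext b' s
    rw [Finsupp.zero_apply, coeff_zero]
    by_contra hs
    have h1 := F.diff_mem i _ _ (single_one_mem_freeDegree b) b' hs
    have h2 := ih b'
    have hs0 : s ≠ 0 := by
      rintro rfl
      exact hs (mem_irrelevantIdeal.1 (hF i _ b'))
    have := weight_pos hd hs0
    push_cast at hb
    omega

end GradedFreeResolution

end Positive

/-! ### Graded Nakayama and minimal covers. -/

section Cover

variable {k : Type u} [Field k] {n : ℕ} {d : Fin (n + 1) → ℤ}
  {A : Type v} [AddCommGroup A] [Module (CoxRing k n) A] (𝓐 : ℤ → AddSubgroup A)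

variable (k d) in
/-- The part of degree `e` of `B A`. -/
def irrelevantPart (e : ℤ) : AddSubgroup A where
  carrier := {m | ∃ g : Fin (n + 1) → A, (∀ j, g j ∈ 𝓐 (e - d j)) ∧
    ∑ j, (X j : CoxRing k n) • g j = m}
  zero_mem' := ⟨0, fun _ => zero_mem _, by simp⟩
  add_mem' := by
    rintro _ _ ⟨g, hg, rfl⟩ ⟨g', hg', rfl⟩
    exact ⟨g + g', fun j => add_mem (hg j) (hg' j), by simp [Finset.sum_add_distrib]⟩
  neg_mem' := by
    rintro _ ⟨g, hg, rfl⟩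
    exact ⟨-g, fun j => neg_mem (hg j), by simp⟩

variable (d) in
lemma C_smul_mem [SetLike.GradedSMul (coxGrading k d) 𝓐] {e : ℤ} (r : k) {m : A} (hm : m ∈ 𝓐 e) :
    (C r : CoxRing k n) • m ∈ 𝓐 e := by
  have : (C r : CoxRing k n) • m ∈ 𝓐 ((0 : ℤ) +ᵥ e) :=
    SetLike.GradedSMul.smul_mem (A := coxGrading k d) (isWeightedHomogeneous_C d r) hm
  rwa [vadd_eq_add, zero_add] at this

variable [SetLike.GradedSMul (coxGrading k d) 𝓐]

lemma smul_mem_irrelevantPart {e e' : ℤ} {p : CoxRing k n} (hp : p ∈ coxGrading k d (e - e'))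
    (hp0 : p.coeff 0 = 0) {m : A} (hm : m ∈ 𝓐 e') : p • m ∈ irrelevantPart k d 𝓐 e := by
  refine ⟨fun j => divMin j p • m, fun j => ?_, ?_⟩
  · have : divMin j p • m ∈ 𝓐 ((e - e' - d j) +ᵥ e') :=
      SetLike.GradedSMul.smul_mem (A := coxGrading k d) (divMin_mem hp) hm
    rwa [vadd_eq_add, show e - e' - d j + e' = e - d j by ring] at this
  · simp only [smul_smul, ← Finset.sum_smul, sum_X_mul_divMin hp0]

variable (k d) in
/-- A basis of `A_e` modulo `(B A)_e`, with coordinate functions. -/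
lemma exists_basis_mod_irrelevantPart (e : ℤ) : ∃ (T : Type v) (v : T → A) (c : T → A →+ k),
    (∀ t, v t ∈ 𝓐 e) ∧
    (∀ m ∈ 𝓐 e, ∃ r : T →₀ k,
      m - r.sum (fun t x => (C x : CoxRing k n) • v t) ∈ irrelevantPart k d 𝓐 e) ∧
    (∀ t, ∀ m ∈ irrelevantPart k d 𝓐 e, c t m = 0) ∧
    (∀ t x, c t ((C x : CoxRing k n) • v t) = x) ∧
    ∀ t s x, t ≠ s → c t ((C x : CoxRing k n) • v s) = 0 := by
  classical
  let _ : Module k A := Module.compHom A (C : k →+* CoxRing k n)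
  have hsmul : ∀ (r : k) (m : A), r • m = (C r : CoxRing k n) • m := fun _ _ => rfl
  let V : Submodule k A := { 𝓐 e with smul_mem' := fun r m hm => C_smul_mem d 𝓐 r hm }
  let W : Submodule k A := { irrelevantPart k d 𝓐 e with
    smul_mem' := by
      rintro r _ ⟨g, hg, rfl⟩
      refine ⟨fun j => (C r : CoxRing k n) • g j, fun j => C_smul_mem d 𝓐 r (hg j), ?_⟩
      rw [hsmul, Finset.smul_sum]
      exact Finset.sum_congr rfl fun j _ => smul_comm _ _ _ }
  let B := Module.Basis.ofVectorSpace k (V.map W.mkQ)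
  have hv : ∀ t, ∃ v ∈ V, W.mkQ v = (B t : A ⧸ W) := fun t => (B t).2
  choose v hv1 hv2 using hv
  -- Coordinates are extended from the image of `A_e` to all of `A / W`, so that they can be applied
  -- to any element of `A`.
  choose c hc using fun t => LinearMap.exists_extend (B.coord t)
  have hcv : ∀ t s, c t (W.mkQ (v s)) = B.coord t (B s) := by
    intro t s
    rw [hv2, ← hc]
    rfl
  refine ⟨_, v, fun t => ((c t).comp W.mkQ).toAddMonoidHom, hv1, ?_, ?_, ?_, ?_⟩
  · intro m hm
    have hmV : W.mkQ m ∈ V.map W.mkQ := Submodule.mem_map_of_mem hm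
    refine ⟨B.repr ⟨W.mkQ m, hmV⟩, ?_⟩
    refine (Submodule.Quotient.mk_eq_zero W).1 ?_
    change W.mkQ (m - _) = 0
    rw [map_sub, sub_eq_zero]
    have h := congrArg Subtype.val (B.linearCombination_repr ⟨W.mkQ m, hmV⟩)
    rw [Finsupp.linearCombination_apply, Finsupp.sum, Submodule.coe_sum] at h
    rw [Finsupp.sum, map_sum]
    refine h.symm.trans ?_
    refine Finset.sum_congr rfl fun t _ => ?_
    rw [← hsmul, map_smul, hv2, Submodule.coe_smul]
  · intro t m hm
    change c t (W.mkQ m) = 0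
    have : W.mkQ m = 0 := (Submodule.Quotient.mk_eq_zero W).2 hm
    rw [this, map_zero]
  · intro t x
    change c t (W.mkQ (x • v t)) = x
    rw [map_smul, map_smul, hcv]
    simp
  · intro t s x hts
    change c t (W.mkQ (x • v s)) = 0
    rw [map_smul, map_smul, hcv]
    simp [Ne.symm hts]

/-- A bounded below graded module is covered by a graded free module, with the kernel contained in
`B F`. -/
lemma exists_graded_cover (hd : ∀ i, 0 < d i) {N : ℤ} (hN : ∀ e < N, 𝓐 e = ⊥) :
    ∃ (ι : Type (max u v)) (a : ι → ℤ) (φ : (ι →₀ CoxRing k n) →ₗ[CoxRing k n] A),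
      (∀ b, N ≤ a b) ∧ (∀ e, ∀ f ∈ freeDegree k d a e, φ f ∈ 𝓐 e) ∧
      (∀ e, ∀ m ∈ 𝓐 e, ∃ f ∈ freeDegree k d a e, φ f = m) ∧
      ∀ e, ∀ f ∈ freeDegree k d a e, φ f = 0 → ∀ b, f b ∈ irrelevantIdeal k n := by
  classical
  choose T v c hv hgen hW hc1 hc2 using exists_basis_mod_irrelevantPart k d 𝓐
  let ι : Type (max u v) := ULift.{u} (Σ e, T e)
  let a : ι → ℤ := fun b => b.down.1
  let V : ι → A := fun b => v b.down.1 b.down.2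
  let φ : (ι →₀ CoxRing k n) →ₗ[CoxRing k n] A := Finsupp.linearCombination (CoxRing k n) V
  have hφ : ∀ f : ι →₀ CoxRing k n, φ f = ∑ b ∈ f.support, f b • V b := fun f => rfl
  have hV : ∀ b, V b ∈ 𝓐 (a b) := fun b => hv _ _
  refine ⟨ι, a, φ, ?_, ?_, ?_, ?_⟩
  · intro b
    by_contra! hb
    have h1 := hV b
    rw [hN _ hb, AddSubgroup.mem_bot] at h1
    have h2 := hc1 b.down.1 b.down.2 1
    change c _ _ ((C 1 : CoxRing k n) • V b) = 1 at h2
    rw [h1, smul_zero, map_zero] at h2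
    exact zero_ne_one h2
  · intro e f hf
    rw [hφ]
    refine sum_mem fun b _ => ?_
    have : f b • V b ∈ 𝓐 ((e - a b) +ᵥ a b) :=
      SetLike.GradedSMul.smul_mem (A := coxGrading k d) (hf b) (hV b)
    rwa [vadd_eq_add, sub_add_cancel] at this
  -- Graded Nakayama, by induction on the distance from the lower bound `N`: modulo the generators
  -- of degree `e`, an element involves only the strictly lower degrees `e - d j`.
  · have key : ∀ (l : ℕ) (e : ℤ), e < N + l → ∀ m ∈ 𝓐 e, ∃ f ∈ freeDegree k d a e, φ f = m := by
      intro l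
      induction l with
      | zero =>
        intro e he m hm
        rw [hN e (by simpa using he), AddSubgroup.mem_bot] at hm
        exact ⟨0, zero_mem _, by rw [map_zero, hm]⟩
      | succ l ih =>
        intro e he m hm
        obtain ⟨r, g, hg, hgm⟩ := hgen e m hm
        choose f hf hfg using fun j => ih (e - d j) (by have := hd j; push_cast at he; omega) _ (hg j)
        refine ⟨∑ t ∈ r.support, Finsupp.single (ULift.up ⟨e, t⟩) (C (r t)) +
          ∑ j, (X j : CoxRing k n) • f j, add_mem (sum_mem fun t _ => ?_) (sum_mem fun j _ => ?_), ?_⟩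
        · refine single_mem_freeDegree ?_
          rw [show e - a (ULift.up ⟨e, t⟩) = 0 from sub_self e]
          exact isWeightedHomogeneous_C d _
        · have := isGradedBy_of_gradedSMul (k := k) (d := d) (freeDegree k d a) j _ _ (hf j)
          rwa [sub_add_cancel] at this
        · rw [map_add, map_sum, map_sum]
          simp only [map_smul, hfg, hgm]
          rw [Finsupp.sum, add_comm, sub_add_eq_add_sub, sub_eq_iff_eq_add]
          congr 1
          refine Finset.sum_congr rfl fun t _ => ?_
          exact Finsupp.linearCombination_single _ _ _
    intro e
    refine key (e - N + 1).toNat e ?_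
    have := Int.self_le_toNat (e - N + 1)
    omega
  · intro e f hf hf0 b
    rw [mem_irrelevantIdeal]
    by_cases hb : a b = e
    -- The coordinates vanish on `(B A)_e`, so they see only constant terms; thus a relation forces
    -- each constant term to vanish.
    · have hsplit : ∀ b', c e (hb ▸ b.down.2) (f b' • V b') =
          c e (hb ▸ b.down.2) ((C ((f b').coeff 0) : CoxRing k n) • V b') := by
        intro b'
        rw [← sub_eq_zero, ← map_sub, ← sub_smul]
        refine hW _ _ _ (smul_mem_irrelevantPart 𝓐 (sub_mem (hf b') ?_) (by simp) (hV b'))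
        by_cases h0 : (f b').coeff 0 = 0
        · rw [h0, C_0]; exact zero_mem _
        · have := hf b' h0
          rw [map_zero] at this
          rw [← this]
          exact isWeightedHomogeneous_C d _
      obtain ⟨⟨e', t⟩⟩ := b
      obtain rfl : e' = e := hb
      have h := congrArg (c e' t) hf0
      rw [hφ, map_sum, map_zero, Finset.sum_congr rfl fun b' _ => hsplit b',
        Finset.sum_eq_single (ULift.up ⟨e', t⟩)] at h
      · exact (hc1 e' t _).symm.trans h
      · rintro ⟨⟨e'', s⟩⟩ _ hne
        by_cases he : e'' = e'
        · subst he
          exact hc2 e'' t s _ fun h => hne (by rw [h])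
        · have h0 : (f ⟨⟨e'', s⟩⟩).coeff 0 = 0 := by
            by_contra h0
            have := hf _ h0
            rw [map_zero] at this
            exact he (by simp only [a] at this; omega)
          rw [h0, C_0, zero_smul, map_zero]
      · intro hs
        rw [Finsupp.notMem_support_iff.1 hs, coeff_zero, C_0, zero_smul, map_zero]
    · by_contra h0
      have := hf b h0
      rw [map_zero] at this
      omega

/-- A bounded below homogeneous submodule of a graded module is covered by a graded free module,
with the kernel contained in `B F`. -/
lemma exists_graded_cover_submodule (hd : ∀ i, 0 < d i) [DirectSum.Decomposition 𝓐] {N : ℤ}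
    (hN : ∀ e < N, 𝓐 e = ⊥) (P : Submodule (CoxRing k n) A)
    (hP : ∀ m ∈ P, ∀ e, (DirectSum.decompose 𝓐 m e : A) ∈ P) :
    ∃ (ι : Type (max u v)) (a : ι → ℤ) (φ : (ι →₀ CoxRing k n) →ₗ[CoxRing k n] A),
      (∀ b, N ≤ a b) ∧ (∀ e, ∀ f ∈ freeDegree k d a e, φ f ∈ 𝓐 e) ∧
      (∀ f e, φ f = 0 → φ (DirectSum.decompose (freeDegree k d a) f e) = 0) ∧
      (∀ m, m ∈ P ↔ ∃ f, φ f = m) ∧ ∀ f, φ f = 0 → ∀ b, f b ∈ irrelevantIdeal k n := by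
  classical
  -- The grading of `P` is kept inside `A`, so the cover maps into `A` directly. It need not
  -- decompose `A`, and `exists_graded_cover` does not ask for that.
  let 𝓟 : ℤ → AddSubgroup A := fun e => 𝓐 e ⊓ P.toAddSubgroup
  have : SetLike.GradedSMul (coxGrading k d) 𝓟 :=
    ⟨fun {i j p m} hp hm => ⟨SetLike.GradedSMul.smul_mem hp (AddSubgroup.mem_inf.1 hm).1,
      P.smul_mem p (AddSubgroup.mem_inf.1 hm).2⟩⟩
  obtain ⟨ι, a, φ, ha, hdeg, hsurj, hker⟩ := exists_graded_cover (k := k) 𝓟 hd (N := N)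
    fun e he => by simp [𝓟, hN e he]
  have hdeg' : ∀ e, ∀ f ∈ freeDegree k d a e, φ f ∈ 𝓐 e := fun e f hf => (hdeg e f hf).1
  have hker' : ∀ f e, φ f = 0 → φ (DirectSum.decompose (freeDegree k d a) f e) = 0 := by
    intro f e hf
    have := decompose_map (freeDegree k d a) 𝓐 φ.toAddMonoidHom hdeg' f e
    refine this.symm.trans ?_
    change ((DirectSum.decompose 𝓐 (φ f)) e : A) = 0
    simp [hf]
  refine ⟨ι, a, φ, ha, hdeg', hker', fun m => ⟨fun hm => ?_, ?_⟩, fun f hf b => ?_⟩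
  · choose f _ hf using fun e => hsurj e _ ⟨SetLike.coe_mem (DirectSum.decompose 𝓐 m e), hP m hm e⟩
    refine ⟨∑ e ∈ (DirectSum.decompose 𝓐 m).support, f e, ?_⟩
    rw [map_sum]
    simp only [hf]
    exact DirectSum.sum_support_decompose 𝓐 m
  · rintro ⟨f, rfl⟩
    rw [← DirectSum.sum_support_decompose (freeDegree k d a) f, map_sum]
    exact sum_mem fun e _ => (hdeg e _ (SetLike.coe_mem _)).2
  · rw [← DirectSum.sum_support_decompose (freeDegree k d a) f, Finsupp.finsetSum_apply]
    exact sum_mem fun e _ => hker e _ (SetLike.coe_mem _) (hker' f e hf) b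

end Cover

/-! ### Iterating covers to a minimal resolution. -/

lemma freeDegree_eq_bot {k : Type u} [Field k] {n : ℕ} {d : Fin (n + 1) → ℤ} (hd : ∀ i, 0 < d i)
    {ι : Type w} {a : ι → ℤ} {N : ℤ} (ha : ∀ b, N ≤ a b) {e : ℤ} (he : e < N) :
    freeDegree k d a e = ⊥ := by
  rw [eq_bot_iff]
  intro f hf
  rw [AddSubgroup.mem_bot]
  ext b s
  rw [Finsupp.zero_apply, coeff_zero]
  by_contra hs
  have h1 := hf b hs
  have h2 := weight_nonneg hd s
  have h3 := ha b
  omega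

variable (k : Type u) [Field k] {n : ℕ} (d : Fin (n + 1) → ℤ) in
/-- A homogeneous submodule of a bounded below graded free module. -/
structure HomogeneousSubmodule where
  /-- The index set of the basis of the free module. -/
  ι : Type w
  /-- The degrees of the basis elements. -/
  shift : ι → ℤ
  /-- The submodule. -/
  carrier : Submodule (CoxRing k n) (ι →₀ CoxRing k n)
  bddBelow : ∃ N, ∀ b, N ≤ shift b
  homogeneous : ∀ f ∈ carrier, ∀ e,
    (DirectSum.decompose (freeDegree k d shift) f e : ι →₀ CoxRing k n) ∈ carrier

/-- A bounded below graded module has a minimal graded free resolution. -/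
theorem exists_minimal_gradedFreeResolution {k : Type u} [Field k] {n : ℕ} {d : Fin (n + 1) → ℤ}
    (hd : ∀ i, 0 < d i) {M : Type v} [AddCommGroup M] [Module (CoxRing k n) M]
    (𝓜 : ℤ → AddSubgroup M) [DirectSum.Decomposition 𝓜]
    [SetLike.GradedSMul (coxGrading k d) 𝓜] (hM : ∃ N : ℤ, ∀ e < N, 𝓜 e = ⊥) :
    ∃ F : GradedFreeResolution.{u, v, max u v} k d 𝓜, F.IsMinimal := by
  -- The kernel of a cover of `P` is again a homogeneous submodule of a bounded below free module,
  -- and the universe `max u v` is preserved, so the step can be iterated.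
  have hstep : ∀ P : HomogeneousSubmodule.{u, max u v} k d,
      ∃ (Q : HomogeneousSubmodule.{u, max u v} k d)
        (φ : (Q.ι →₀ CoxRing k n) →ₗ[CoxRing k n] (P.ι →₀ CoxRing k n)),
        (∀ e, ∀ f ∈ freeDegree k d Q.shift e, φ f ∈ freeDegree k d P.shift e) ∧
        (∀ m, m ∈ P.carrier ↔ ∃ f, φ f = m) ∧ (∀ f, φ f = 0 ↔ f ∈ Q.carrier) ∧
        ∀ f ∈ Q.carrier, ∀ b, f b ∈ irrelevantIdeal k n := by
    intro P
    obtain ⟨N, hN⟩ := P.bddBelow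
    obtain ⟨ι, a, φ, ha, hdeg, hhom, hrange, hker⟩ := exists_graded_cover_submodule
      (freeDegree k d P.shift) hd (fun e => freeDegree_eq_bot hd hN) P.carrier P.homogeneous
    exact ⟨⟨ι, a, LinearMap.ker φ, ⟨N, ha⟩, fun f hf e => hhom f e hf⟩, φ, hdeg, hrange,
      fun f => Iff.rfl, hker⟩
  choose next φ hdeg hrange hker hB using hstep
  obtain ⟨N, hN⟩ := hM
  obtain ⟨ι, a, aug, ha, hdeg0, hhom0, hrange0, hker0⟩ := exists_graded_cover_submodule
    (k := k) 𝓜 hd hN ⊤ (fun _ _ _ => trivial)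
  let P : ℕ → HomogeneousSubmodule.{u, max u v} k d := fun i =>
    Nat.rec ⟨ι, a, LinearMap.ker aug, ⟨N, ha⟩, fun f hf e => hhom0 f e hf⟩ (fun _ Q => next Q) i
  have hP : ∀ i, ∀ f ∈ (P i).carrier, ∀ b, f b ∈ irrelevantIdeal k n := by
    intro i
    cases i with
    | zero => exact hker0
    | succ i => exact hB (P i)
  refine ⟨{ ι := fun i => (P i).ι
            shift := fun i => (P i).shift
            diff := fun i => φ (P i)
            aug := aug
            diff_mem := fun i => hdeg (P i)
            aug_mem := hdeg0
            aug_surjective := fun m => (hrange0 m).1 trivial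
            exact_zero := fun f => hrange (P 0) f
            exact_succ := fun i f => (hker (P i) f).trans (hrange (P (i + 1)) f) }, ?_⟩
  intro i f b
  exact hP i _ ((hrange (P i) _).2 ⟨f, rfl⟩) b

end WeightedProj

theorem proposition6p3 {k : Type u} [Field k] {n : ℕ}
    (d : Fin (n + 1) → ℤ) (hd_pos : ∀ i, 0 < d i) (hd_mono : Monotone d)
    {M : Type v} [AddCommGroup M] [Module (WeightedProj.CoxRing k n) M]
    (𝓜 : ℤ → AddSubgroup M) [DirectSum.Decomposition 𝓜]
    [SetLike.GradedSMul (WeightedProj.coxGrading k d) 𝓜]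
    (hM : ∃ N : ℤ, ∀ e < N, 𝓜 e = ⊥)
    (hreg : WeightedProj.IsZeroRegular k d 𝓜) :
    (∃ F : WeightedProj.GradedFreeResolution.{u, v, max u v} k d 𝓜,
      (∀ i, n + 1 < i → IsEmpty (F.ι i)) ∧
      ∀ i ≤ n + 1, ∀ b : F.ι i, F.shift i b < WeightedProj.topWeight d ((i : ℤ) + 1)) ∧
    (WeightedProj.GeneratedInDegreeGE k n 𝓜 0 →
      (∃ F : WeightedProj.GradedFreeResolution.{u, v, max u v} k d 𝓜, F.IsMinimal) ∧
      ∀ F : WeightedProj.GradedFreeResolution.{u, v, w} k d 𝓜, F.IsMinimal →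
        (∀ i, n + 1 < i → IsEmpty (F.ι i)) ∧
        ∀ i ≤ n + 1, ∀ b : F.ι i,
          (i : ℤ) ≤ F.shift i b ∧ F.shift i b < WeightedProj.topWeight d ((i : ℤ) + 1)) := by
  -- The upper bounds hold for every minimal resolution, without any condition on the generators of
  -- `M`.
  have hupper : ∀ F : WeightedProj.GradedFreeResolution.{u, v, max u v} k d 𝓜, F.IsMinimal →
      (∀ i, n + 1 < i → IsEmpty (F.ι i)) ∧
      ∀ i ≤ n + 1, ∀ b : F.ι i, F.shift i b < WeightedProj.topWeight d ((i : ℤ) + 1) :=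
    fun F hF => ⟨fun i hi => hF.isEmpty hi, fun i _ b => not_le.1 fun h =>
      hF.shift_ne (hreg.koszulExact hd_pos hd_mono h) b rfl⟩
  obtain ⟨F, hF⟩ := WeightedProj.exists_minimal_gradedFreeResolution (k := k) hd_pos 𝓜 hM
  refine ⟨⟨F, hupper F hF⟩, fun hgen => ⟨⟨F, hF⟩, fun F hF => ⟨fun i hi => hF.isEmpty hi,
    fun i _ b => ⟨hF.le_shift hd_pos
      (fun e he => WeightedProj.eq_bot_of_generatedInDegreeGE (k := k) hd_pos hgen he) i b,
      not_le.1 fun h => hF.shift_ne (hreg.koszulExact hd_pos hd_mono h) b rfl⟩⟩⟩⟩
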